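/- Let $p,p'$ be relatively prime integers with $3\le p$ and $1<t<2$, where $t=p'/p$. For integers $r,s$ put $\Delta_{r,s}=\frac{(rt-s)^2-(t-1)^2}{4t}$. Let $[x]$ be the integer part of $x$, $\{x\}=x-[x]$, and $\tau(s)=\left[\frac{s+1}{t}\right]-\left[\frac{s-1}{t}\right]$, which is $1$ or $2$. **Labels.** A *labelling* is a map $\rho:\{1,\dots,p'-1\}\to\{1_A,1_B,2\}$ such that (i) $\rho(s)=2$ if and only if $\tau(s)=2$; (ii) $\rho(1)=1_A$, and $\rho(2)=1_B$ if $t>\frac32$; (iii) for $2\le s\le p'-2$, $\rho(s)=1_A$ if and only if $\rho(p'-s)=1_B$; (iv) if $\rho(s)=1_B$ and $s+2\le p'-1$, then $\rho(s+2)\ne1_A$. The *standard labelling* is the following map. Where $\tau(s)=2$ its value is $2$. For the $s$ with $\tau(s)=1$: if $1<t\le\frac53$, then $s$ is labelled $1_A$ for $s<p'/2$ and $1_B$ for $s>p'/2$, except that for $\frac32<t\le\frac53$ one labels $2$ by $1_B$ and $p'-2$ by $1_A$; if $\frac53<t<2$, then the labels alternate $1_A,1_B,1_A,1_B,\dots$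 starting with $1_A$ at $s=1$, and the alternation is restarted with $1_B$ after every $s$ with $\tau(s)=2$. **Weights.** Given a labelling $\rho$, put $(x(s),y(s))=(2,3),(3,2),(2,4)$ according to $\rho(s)=1_A,1_B,2$, and $$w(s\pm2,s,s\mp2)=\tfrac2t,\qquad w(s,s+2,s+2)=w(s+2,s+2,s)=2-\left\{\tfrac{s+1}t\right\},$$ $$w(s,s,s+2)=w(s+2,s,s)=1+\left\{\tfrac{s+1}t\right\},\qquad w(s,s+2,s)=-2\left\{\tfrac{s+1}t\right\}+x(s),$$ $$w(s,s,s)=3-\tau(s),\qquad w(s,s-2,s)=2\left\{\tfrac{s+1}t\right\}-\tfrac4t+y(s).$$ **Paths.** $\mathcal P_{a,b,m}$ is the set of integer sequences $\mathbf s=(s_0,\dots,s_m)$ with $s_0=a$, $s_m=b$, $1\le s_i\le p'-1$ for all $i$, and $s_i-s_{i+1}\in\{0,2,-2\}$, $(s_i,s_{i+1})\ne(1,1),(p'-1,p'-1)$ for $0\le i<m$. Put $E(\mathbf s)=\sum_{i=1}^{m-1}i\,w(s_{i-1},s_i,s_{i+1})$. **The alternating sum.** Let $(x)_n=\prod_{i=0}^{n-1}(1-q^ix)$,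 and let $\left[{L\atop a}\right]_q=(q^{L-a+1})_a/(q)_a$ for $a\ge0$ and $0$ for $a<0$. Let $S_{m,l}(q)$ be the $q$-supernomial coefficient $\left[{0,m\atop l}\right]$ taken at $q^{-1}$, where $\left[{0,m\atop l}\right]_q=\sum_{j=0}^m q^{(l+m-j)(m-j)}\left[{m\atop j}\right]_q\left[{j\atop l+m-j}\right]_q$; explicitly, $$S_{m,l}(q)=\sum_{\nu\in\mathbb Z}q^{(\nu+l-m)(\nu+l)+\nu(\nu-m)}\left[{m\atop\nu}\right]_q\left[{\nu\atop m-l-\nu}\right]_q .$$ For $a\equiv b\bmod2$ put $$I^{(p,p')}_{r,a,b,m}(q)=\sum_{\lambda\in\mathbb Z}q^{\lambda^2pp'+\lambda(p'r-pa)+m^2-((a-b)/2-p'\lambda)^2}S_{m,(a-b)/2-p'\lambda}(q) -\sum_{\lambda\in\mathbb Z}q^{\lambda^2pp'+\lambda(p'r+pa)+ra+m^2-((a+b)/2+p'\lambda)^2}S_{m,(a+b)/2+p'\lambda}(q)$$ (finite sums). **Proposition.** The standard labelling is a labelling. Let $\rho$ be any labelling (in particular the standard one) and $w$, $E$ the corresponding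 weights. Let $1\le r\le p-1$, $1\le a\le p'-1$, and let $b$ with $1\le b\le p'-1$, $b\equiv a\bmod2$ be such that $$\Delta_{r,b}=\min_{1\le s\le p'-1,\ s\equiv a\bmod2}\Delta_{r,s}.$$ Then for every integer $m\ge0$ all exponents of $q$ on the right-hand side below are integers, and $$I^{(p,p')}_{r,a,b,m}(q)=\sum_{\mathbf s\in\mathcal P_{a,b,m}}q^{E(\mathbf s)+m(\Delta_{r,s_{m-1}}-\Delta_{r,b}+\delta_{s_{m-1},b})+\Delta_{r,b}-\Delta_{r,a}},$$ where for $m=0$ the term with the factor $m$ is read as $0$. In particular $I^{(p,p')}_{r,a,b,m}(q)$ is a Laurent polynomial in $q$ with non-negative integer coefficients. -/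

import Mathlib

namespace VirasoroPaths

noncomputable section

/-! ### q-binomials and q-supernomials, with base `q` in an arbitrary field -/

section qSeries

variable {K : Type*} [Field K]

/-- The finite product `(x)_n = ∏_{i<n} (1 - q^i x)`. -/
def qPoch (q x : K) (n : ℕ) : K :=
  ∏ i ∈ Finset.range n, (1 - q ^ i * x)

/-- The q-binomial symbol `[L; a]_q = (q^{L-a+1})_a / (q)_a` for `a ≥ 0` and `L ∈ ℤ`, and `0` for
`a < 0`. -/
def qBinom (q : K) (L a : ℤ) : K :=
  if 0 ≤ a then qPoch q (q ^ (L - a + 1)) a.toNat / qPoch q q a.toNat else 0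

/-- The two-row q-supernomial coefficient `[L₁, L₂; l]_q` of Schilling and Warnaar:
the sum over all `j₁ + j₂ = l + (L₁ + 2 L₂) / 2` of
`q^{j₁ (L₂ - j₂)} [L₂; j₂]_q [L₁ + j₂; j₁]_q`
(outside `0 ≤ j₂ ≤ L₂`, `0 ≤ j₁ ≤ L₁ + L₂` the summand is zero). -/
def supernomial (q : K) (L₁ L₂ : ℕ) (l : ℚ) : K :=
  ∑ j₂ ∈ Finset.range (L₂ + 1), ∑ j₁ ∈ Finset.range (L₁ + L₂ + 1),
    if (j₁ + j₂ : ℚ) = l + (L₁ + 2 * L₂) / 2 then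
      q ^ ((j₁ : ℤ) * (L₂ - j₂)) * qBinom q L₂ j₂ * qBinom q (L₁ + j₂) j₁
    else 0

/-- `S_{m,l}(q) = [0, m; l]_{q⁻¹}`. -/
def S (q : K) (m : ℕ) (l : ℤ) : K :=
  supernomial q⁻¹ 0 m l

/-! The next lemmas give the closed form of `S`. -/

lemma qPoch_self_ne_zero {q : K} (hq : ∀ n : ℕ, 0 < n → q ^ n ≠ 1) (n : ℕ) :
    qPoch q q n ≠ 0 := by
  unfold qPoch
  rw [Finset.prod_ne_zero_iff]
  intro i _ h
  apply hq (i + 1) (Nat.succ_pos i)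
  rw [pow_succ]
  exact (sub_eq_zero.mp h).symm

lemma qBinom_of_add {q : K} (hq : ∀ n : ℕ, 0 < n → q ^ n ≠ 1) (k d : ℕ) :
    qBinom q ((k : ℤ) + d) k = qPoch q q (d + k) / (qPoch q q k * qPoch q q d) := by
  have h : qPoch q q (d + k) = qPoch q q d * qPoch q (q ^ ((k : ℤ) + d - k + 1)) k := by
    unfold qPoch
    rw [Finset.prod_range_add]
    congr 1
    refine Finset.prod_congr rfl fun i _ => ?_
    have e : ((k : ℤ) + d - k + 1) = ((d + 1 : ℕ) : ℤ) := by push_cast; ring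
    rw [e, zpow_natCast]
    ring
  have h1 := qPoch_self_ne_zero hq d
  have h2 := qPoch_self_ne_zero hq k
  unfold qBinom
  rw [if_pos (Int.natCast_nonneg k), Int.toNat_natCast, h]
  field_simp

lemma qBinom_of_neg (q : K) (L k : ℤ) (h : k < 0) : qBinom q L k = 0 := by
  unfold qBinom
  rw [if_neg (by omega)]

lemma qBinom_of_lt {q : K} (h0 : q ≠ 0) (L k : ℤ) (hL : 0 ≤ L) (h : L < k) :
    qBinom q L k = 0 := by
  unfold qBinom
  rw [if_pos (by omega), div_eq_zero_iff]
  left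
  unfold qPoch
  rw [Finset.prod_eq_zero_iff]
  refine ⟨(k - L - 1).toNat, by simp; omega, ?_⟩
  rw [← zpow_natCast, ← zpow_add₀ h0, sub_eq_zero]
  have e : ((k - L - 1).toNat : ℤ) + (L - k + 1) = 0 := by omega
  rw [e, zpow_zero]

/-- The sign and power of `q` that `(q)_n` acquires under `q ↦ q⁻¹`. -/
def invFactor (q : K) (n : ℕ) : K :=
  ∏ i ∈ Finset.range n, (-(q ^ (i + 1))⁻¹)

lemma invFactor_ne_zero {q : K} (h0 : q ≠ 0) (n : ℕ) : invFactor q n ≠ 0 := by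
  unfold invFactor
  rw [Finset.prod_ne_zero_iff]
  intro i _
  exact neg_ne_zero.mpr (inv_ne_zero (pow_ne_zero _ h0))

lemma invFactor_add (q : K) (a b : ℕ) :
    invFactor q (a + b) = invFactor q a * invFactor q b * q ^ (-((a : ℤ) * b)) := by
  unfold invFactor
  rw [Finset.prod_range_add, mul_assoc]
  congr 1
  have e : q ^ (-((a : ℤ) * b)) = ∏ _i ∈ Finset.range b, (q ^ a)⁻¹ := by
    rw [Finset.prod_const, Finset.card_range, zpow_neg, zpow_mul, zpow_natCast, zpow_natCast,
      inv_pow]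
  rw [e, ← Finset.prod_mul_distrib]
  refine Finset.prod_congr rfl fun i _ => ?_
  rw [add_assoc, pow_add, mul_inv]
  ring

lemma qPoch_inv {q : K} (h0 : q ≠ 0) (n : ℕ) :
    qPoch q⁻¹ q⁻¹ n = invFactor q n * qPoch q q n := by
  unfold qPoch invFactor
  rw [← Finset.prod_mul_distrib]
  refine Finset.prod_congr rfl fun i _ => ?_
  rw [inv_pow, ← mul_inv, ← pow_succ]
  have := pow_ne_zero (i + 1) h0
  field_simp
  ring

lemma qBinom_inv_of_add {q : K} (h0 : q ≠ 0) (hq : ∀ n : ℕ, 0 < n → q ^ n ≠ 1) (k d : ℕ) :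
    qBinom q⁻¹ ((k : ℤ) + d) k =
      q ^ (-((k : ℤ) * d)) * (qPoch q q (d + k) / (qPoch q q k * qPoch q q d)) := by
  have hq' : ∀ n : ℕ, 0 < n → (q⁻¹) ^ n ≠ 1 := by
    intro n hn h
    apply hq n hn
    rwa [inv_pow, inv_eq_one] at h
  rw [qBinom_of_add hq', qPoch_inv h0, qPoch_inv h0, qPoch_inv h0, invFactor_add]
  have h1 := invFactor_ne_zero h0 k
  have h2 := invFactor_ne_zero h0 d
  have h3 := qPoch_self_ne_zero hq k
  have h4 := qPoch_self_ne_zero hq d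
  rw [mul_comm (d : ℤ)]
  field_simp

/-- The closed form of `S`. -/
theorem S_eq {q : K} (h0 : q ≠ 0) (hq : ∀ n : ℕ, 0 < n → q ^ n ≠ 1) (m : ℕ) (l : ℤ) :
    S q m l = ∑ᶠ ν : ℤ, q ^ ((ν + l - m) * (ν + l) + ν * (ν - m)) *
      qBinom q m ν * qBinom q ν (m - l - ν) := by
  classical
  set T : ℤ → K := fun j =>
    if 0 ≤ l + m - j ∧ l + m - j ≤ j ∧ j ≤ m then
      q ^ (-((m - j) * j) - (j - l) * (l + m - j)) *
        (qPoch q q m / (qPoch q q (m - j).toNat * qPoch q q (l + m - j).toNat *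
          qPoch q q (2 * j - l - m).toNat)) else 0 with hT
  have hR : ∀ j : ℤ, q ^ (((j - l) + l - m) * ((j - l) + l) + (j - l) * ((j - l) - m)) *
      qBinom q m (j - l) * qBinom q (j - l) (m - l - (j - l)) = T j := by
    intro j
    by_cases h : 0 ≤ l + m - j ∧ l + m - j ≤ j ∧ j ≤ m
    · obtain ⟨u, hu⟩ := Int.eq_ofNat_of_zero_le h.1
      obtain ⟨v, hv⟩ := Int.eq_ofNat_of_zero_le (sub_nonneg.mpr h.2.1)
      obtain ⟨w, hw⟩ := Int.eq_ofNat_of_zero_le (sub_nonneg.mpr h.2.2)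
      have e1 : j - l = ((w + v : ℕ) : ℤ) := by push_cast; omega
      have e2 : (m : ℤ) = ((w + v : ℕ) : ℤ) + u := by push_cast; omega
      have e3 : m - l - (j - l) = (w : ℤ) := by omega
      have e4 : m = u + (w + v) := by omega
      have b1 : qBinom q m (j - l) = qPoch q q m / (qPoch q q (w + v) * qPoch q q u) := by
        rw [e1, e2, qBinom_of_add hq, ← e4]
      have b2 : qBinom q (j - l) (m - l - (j - l)) =
          qPoch q q (v + w) / (qPoch q q w * qPoch q q v) := by
        rw [e3, e1]
        push_cast
        exact qBinom_of_add hq w v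
      have t1 : (m - j : ℤ).toNat = w := by omega
      have t2 : (l + m - j : ℤ).toNat = u := by omega
      have t3 : (2 * j - l - m : ℤ).toNat = v := by omega
      have n1 := qPoch_self_ne_zero hq (w + v)
      have n2 := qPoch_self_ne_zero hq u
      have n3 := qPoch_self_ne_zero hq v
      have n4 := qPoch_self_ne_zero hq w
      simp only [hT, if_pos h]
      rw [b1, b2, t1, t2, t3, add_comm v w, mul_assoc]
      congr 1
      · congr 1
        ring
      · field_simp
    · simp only [hT, if_neg h]
      by_cases h1 : j - l < 0
      · rw [qBinom_of_neg q m _ h1]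
        simp
      by_cases h2 : (m : ℤ) < j - l
      · rw [qBinom_of_lt h0 m _ (by omega) h2]
        simp
      by_cases h3 : m - l - (j - l) < 0
      · rw [qBinom_of_neg q (j - l) _ h3]
        simp
      rw [qBinom_of_lt h0 (j - l) (m - l - (j - l)) (by omega) (by omega)]
      simp
  have hL : ∀ j : ℕ, j ∈ Finset.range (m + 1) →
      (∑ j₁ ∈ Finset.range (0 + m + 1),
        if ((j₁ : ℕ) + (j : ℕ) : ℚ) = l + ((0 : ℕ) + 2 * m) / 2 then
          q⁻¹ ^ ((j₁ : ℤ) * (m - j)) * qBinom q⁻¹ m j * qBinom q⁻¹ ((0 : ℕ) + j) j₁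
        else 0) = T j := by
    intro j hj
    have hj' : j ≤ m := by simpa [Nat.lt_succ_iff] using hj
    have hc : ∀ j₁ : ℕ, (((j₁ : ℕ) + (j : ℕ) : ℚ) = l + ((0 : ℕ) + 2 * m) / 2) ↔
        (j₁ : ℤ) = l + m - j := by
      intro j₁
      have e : (l : ℚ) + ((0 : ℕ) + 2 * m) / 2 = l + m := by push_cast; ring
      rw [e]
      constructor
      · intro h
        have : ((j₁ : ℤ) + j : ℤ) = l + m := by exact_mod_cast h
        omega
      · intro h
        have : ((j₁ : ℤ) + j : ℤ) = l + m := by omega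
        exact_mod_cast this
    simp only [hc]
    by_cases h : 0 ≤ l + m - j ∧ l + m - j ≤ j ∧ (j : ℤ) ≤ m
    · obtain ⟨u, hu⟩ := Int.eq_ofNat_of_zero_le h.1
      obtain ⟨v, hv⟩ := Int.eq_ofNat_of_zero_le (sub_nonneg.mpr h.2.1)
      obtain ⟨w, hw⟩ := Int.eq_ofNat_of_zero_le (sub_nonneg.mpr h.2.2)
      rw [Finset.sum_eq_single u]
      · rw [if_pos (by omega)]
        have e2 : (m : ℤ) = (j : ℤ) + w := by omega
        have e3 : (((0 : ℕ) : ℤ) + (j : ℤ)) = (u : ℤ) + v := by push_cast; omega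
        have e4 : w + j = m := by omega
        have e5 : v + u = j := by omega
        have b1 : qBinom q⁻¹ m j = q ^ (-((j : ℤ) * w)) *
            (qPoch q q m / (qPoch q q j * qPoch q q w)) := by
          rw [e2, qBinom_inv_of_add h0 hq, e4]
        have b2 : qBinom q⁻¹ (((0 : ℕ) : ℤ) + (j : ℤ)) u = q ^ (-((u : ℤ) * v)) *
            (qPoch q q j / (qPoch q q u * qPoch q q v)) := by
          rw [e3, qBinom_inv_of_add h0 hq, e5]
        have t1 : (m - j : ℤ).toNat = w := by omega
        have t2 : (l + m - j : ℤ).toNat = u := by omega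
        have t3 : (2 * j - l - m : ℤ).toNat = v := by omega
        have n1 := qPoch_self_ne_zero hq j
        have n2 := qPoch_self_ne_zero hq u
        have n3 := qPoch_self_ne_zero hq v
        have n4 := qPoch_self_ne_zero hq w
        simp only [hT, if_pos h]
        rw [b1, b2, t1, t2, t3, inv_zpow, ← zpow_neg]
        have e6 : -((m - j) * j : ℤ) - (j - l) * (l + m - j) =
            -(u * (m - j) : ℤ) + -(j * w : ℤ) + -(u * v : ℤ) := by
          have a1 : (m : ℤ) = u + v + w := by omega
          have a2 : (j : ℤ) = u + v := by omega
          have a3 : l = u - w := by omega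
          rw [a1, a2, a3]
          ring
        rw [e6, zpow_add₀ h0, zpow_add₀ h0]
        field_simp
      · intro i _ hi
        rw [if_neg (by omega)]
      · intro hu'
        exfalso
        apply hu'
        simp
        omega
    · simp only [hT, if_neg h]
      refine Finset.sum_eq_zero fun i _ => ?_
      split_ifs with hi
      · rw [qBinom_of_lt (inv_ne_zero h0) _ (i : ℤ) (by positivity) (by omega)]
        simp
      · rfl
  have hfin : ∑ᶠ ν : ℤ, q ^ ((ν + l - m) * (ν + l) + ν * (ν - m)) *
      qBinom q m ν * qBinom q ν (m - l - ν) = ∑ᶠ j : ℤ, T j := by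
    rw [← finsum_comp_equiv (Equiv.subRight l)]
    refine finsum_congr fun j => ?_
    simp only [Equiv.subRight_apply]
    exact hR j
  rw [hfin, finsum_eq_sum_of_support_subset (s := (Finset.range (m + 1)).image (fun j : ℕ => (j : ℤ)))]
  · rw [Finset.sum_image (fun x _ y _ h => by exact_mod_cast h)]
    unfold S supernomial
    exact Finset.sum_congr rfl hL
  · intro j hj
    by_contra hn
    apply hj
    simp only [hT]
    rw [if_neg]
    rintro ⟨h1, h2, h3⟩
    apply hn
    simp only [Finset.coe_image, Finset.coe_range, Set.mem_image, Set.mem_Iio]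
    exact ⟨j.toNat, by omega, by omega⟩

/-- `S_{m,l}` vanishes for `m < |l|`. -/
theorem S_eq_zero {q : K} (h0 : q ≠ 0) (hq : ∀ n : ℕ, 0 < n → q ^ n ≠ 1) (m : ℕ) (l : ℤ)
    (hl : (m : ℤ) < |l|) : S q m l = 0 := by
  rw [S_eq h0 hq]
  refine finsum_eq_zero_of_forall_eq_zero fun ν => ?_
  by_cases h1 : ν < 0
  · rw [qBinom_of_neg q m _ h1]
    simp
  by_cases h2 : (m : ℤ) < ν
  · rw [qBinom_of_lt h0 m _ (by omega) h2]
    simp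
  by_cases h3 : m - l - ν < 0
  · rw [qBinom_of_neg q ν _ h3]
    simp
  rw [qBinom_of_lt h0 ν (m - l - ν) (by omega) (by rcases lt_abs.mp hl with h | h <;> omega)]
  simp

end qSeries

/-! ### Labels and weights -/

/-- `t = p'/p`. -/
def tpar (p p' : ℕ) : ℚ := (p' : ℚ) / p

/-- The conformal weight `Δ_{r,s} = ((r t - s)^2 - (t - 1)^2) / (4 t)`. -/
def confWeight (p p' : ℕ) (r s : ℤ) : ℚ :=
  ((r * tpar p p' - s) ^ 2 - (tpar p p' - 1) ^ 2) / (4 * tpar p p')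

/-- `b = b(r, a)`: `Δ_{r,b}` is the minimum of the `Δ_{r,s}` over `1 ≤ s ≤ p' - 1`,
`s ≡ a mod 2`. -/
structure IsMinimizer (p p' : ℕ) (r a b : ℤ) : Prop where
  one_le : 1 ≤ b
  le : b ≤ p' - 1
  parity : b ≡ a [ZMOD 2]
  min : ∀ s : ℤ, 1 ≤ s → s ≤ p' - 1 → s ≡ a [ZMOD 2] → confWeight p p' r b ≤ confWeight p p' r s

/-- `τ(s) = [(s+1)/t] - [(s-1)/t]`. -/
def tau (p p' : ℕ) (s : ℤ) : ℤ :=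
  ⌊((s : ℚ) + 1) / tpar p p'⌋ - ⌊((s : ℚ) - 1) / tpar p p'⌋

/-- The three cases `1_A`, `1_B`, `2`. -/
inductive Label
  | oneA
  | oneB
  | two

/-- The integers `x` of the three cases. -/
def Label.x : Label → ℤ
  | .oneA => 2
  | .oneB => 3
  | .two => 2

/-- The integers `y` of the three cases. -/
def Label.y : Label → ℤ
  | .oneA => 3
  | .oneB => 2
  | .two => 4

/-- `ρ` refines `τ` on `{1, …, p' - 1}`: it records the case of `s`, that is `2` where `τ(s) = 2`,
and a choice of `1_A` or `1_B` elsewhere, subject to the required constraints. -/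
structure IsLabelling (p p' : ℕ) (ρ : ℤ → Label) : Prop where
  /-- The label is `2` exactly where `τ` is `2`. -/
  two_iff : ∀ s : ℤ, 1 ≤ s → s ≤ p' - 1 → (ρ s = .two ↔ tau p p' s = 2)
  /-- The label of `1` is `1_A`. -/
  at_one : ρ 1 = .oneA
  /-- The label of `2` is `1_B` if `3/2 < t`. -/
  at_two : 3 / 2 < tpar p p' → ρ 2 = .oneB
  /-- `s ↦ p' - s` exchanges `1_A` and `1_B`. -/
  symm : ∀ s : ℤ, 2 ≤ s → s ≤ p' - 2 → (ρ s = .oneA ↔ ρ (p' - s) = .oneB)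
  /-- If `s` has label `1_B`, then `s + 2` does not have label `1_A`. -/
  no_BA : ∀ s : ℤ, 1 ≤ s → s + 2 ≤ p' - 1 → ρ s = .oneB → ρ (s + 2) ≠ .oneA

/-- The sequence `1_A, 1_B, 1_A, 1_B, …` in which `2` is written wherever `τ = 2`, and which is
resumed with `1_B` after each `2`. The value at `0` only serves to start it with `1_A`. -/
def alternating (p p' : ℕ) : ℕ → Label
  | 0 => .oneB
  | n + 1 =>
    if tau p p' (n + 1) = 2 then .two
    else match alternating p p' n with
      | .oneA => .oneB
      | .oneB => .oneA
      | .two => .oneB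

/-- The standard choice of the labels. For `t ≤ 5/3` it is `1_A` in the left half and `1_B` in the
right half of `{1, …, p' - 1}`, except for the values `1_B` at `2` and `1_A` at `p' - 2` forced
by the constraints if `3/2 < t`. For `5/3 < t` it is the alternating one. -/
def standardLabel (p p' : ℕ) (s : ℤ) : Label :=
  if tau p p' s = 2 then .two
  else if tpar p p' ≤ 5 / 3 then
    if 3 / 2 < tpar p p' ∧ s = 2 then .oneB
    else if 3 / 2 < tpar p p' ∧ s = p' - 2 then .oneA
    else if 2 * s < p' then .oneA
    else .oneB
  else alternating p p' s.toNat

/-- The weight `w(a, b, c)`; here `{·}` is `Int.fract`. The lines are, in this order, the weights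
`w(s±2,s,s∓2)`, `w(s,s+2,s+2)`, `w(s+2,s+2,s)`, `w(s,s,s+2)`, `w(s+2,s,s)`, `w(s,s+2,s)`,
`w(s,s,s)`, `w(s,s-2,s)`. The last value is never used on paths. -/
def weight (p p' : ℕ) (ρ : ℤ → Label) (a b c : ℤ) : ℚ :=
  if (a = b + 2 ∧ c = b - 2) ∨ (a = b - 2 ∧ c = b + 2) then 2 / tpar p p'
  else if b = a + 2 ∧ c = a + 2 then 2 - Int.fract (((a : ℚ) + 1) / tpar p p')
  else if a = c + 2 ∧ b = c + 2 then 2 - Int.fract (((c : ℚ) + 1) / tpar p p')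
  else if b = a ∧ c = a + 2 then 1 + Int.fract (((a : ℚ) + 1) / tpar p p')
  else if a = b + 2 ∧ c = b then 1 + Int.fract (((b : ℚ) + 1) / tpar p p')
  else if b = a + 2 ∧ c = a then -2 * Int.fract (((a : ℚ) + 1) / tpar p p') + (ρ a).x
  else if b = a ∧ c = a then 3 - tau p p' a
  else if b = a - 2 ∧ c = a then
    2 * Int.fract (((a : ℚ) + 1) / tpar p p') - 4 / tpar p p' + (ρ a).y
  else 0

/-! ### Paths -/

open Classical in
/-- The paths `(s_0, …, s_m)` with `s_0 = a` and `s_m = b`. -/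
def paths (p' : ℕ) (a b : ℤ) (m : ℕ) : Finset (Fin (m + 1) → ℤ) :=
  (Fintype.piFinset fun _ : Fin (m + 1) => Finset.Icc (1 : ℤ) (p' - 1)).filter fun s =>
    s 0 = a ∧ s (Fin.last m) = b ∧
    ∀ i : Fin m,
      (s i.castSucc = s i.succ ∨ s i.castSucc = s i.succ + 2 ∨ s i.castSucc = s i.succ - 2) ∧
      ¬ (s i.castSucc = 1 ∧ s i.succ = 1) ∧
      ¬ (s i.castSucc = p' - 1 ∧ s i.succ = p' - 1)

/-- `E(s) = ∑_{i=1}^{m-1} i w(s_{i-1}, s_i, s_{i+1})`; the summation index is `i - 1`. -/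
def energy (p p' : ℕ) (ρ : ℤ → Label) {m : ℕ} (s : Fin (m + 1) → ℤ) : ℚ :=
  ∑ i : Fin (m - 1), ((i : ℕ) + 1 : ℚ) *
    weight p p' ρ (s ⟨i, by omega⟩) (s ⟨i + 1, by omega⟩) (s ⟨i + 2, by omega⟩)

/-- The exponent `E(s) + m (Δ_{r,s_{m-1}} - Δ_{r,b} + δ_{s_{m-1},b}) + Δ_{r,b} - Δ_{r,a}`.
For `m = 0` the middle term is zero. -/
def exponent (p p' : ℕ) (ρ : ℤ → Label) (r a b : ℤ) {m : ℕ} (s : Fin (m + 1) → ℤ) : ℚ :=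
  energy p p' ρ s +
    m * (confWeight p p' r (s ⟨m - 1, by omega⟩) - confWeight p p' r b +
      (if s ⟨m - 1, by omega⟩ = b then 1 else 0)) +
    confWeight p p' r b - confWeight p p' r a

/-! ### The alternating sum -/

/-- The alternating sum `I_{r,a,b,m}(q)`, for `a ≡ b mod 2`. Both sums are finite, since `S_{m,l}`
vanishes for `m < |l|`. -/
def altSum {K : Type*} [Field K] (q : K) (p p' : ℕ) (r a b : ℤ) (m : ℕ) : K :=
  (∑ᶠ k : ℤ, q ^ (k ^ 2 * p * p' + k * (p' * r - p * a) + m ^ 2 - ((a - b) / 2 - p' * k) ^ 2) *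
    S q m ((a - b) / 2 - p' * k)) -
  ∑ᶠ k : ℤ, q ^ (k ^ 2 * p * p' + k * (p' * r + p * a) + r * a + m ^ 2
      - ((a + b) / 2 + p' * k) ^ 2) *
    S q m ((a + b) / 2 + p' * k)

end

end VirasoroPaths

/-! Both sides satisfy the same recursion in the length `m`.

Write `q^(m²-l²) S_{m,l} = (q)_m T(m,l)`, where `T(m,l)` sums `q^(nm+2ij) / ((q)_i (q)_j (q)_n)`
over `i-j = l`, `i+j+n = m` (`zpow_mul_S`). By the method of images, the alternating sum is, up to
`(q)_m` and a power of `q`, the sum `F(m,r,b)` of `C(b+2l) q^(-rl) T(m,l)` over `l` (`imageSum`,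
`altSum_eq`). Here `C` lives on the images of `a` under the reflections in `0` and `p'`. It is
antisymmetric, so `F` vanishes on the walls, and strictly between them it is the delta function at
`a`.

On the path side each weight is an integer plus a second difference of `s²/(4t)` (`weight_eq`).
Multiplied by `i` and summed, the second differences leave boundary terms, which the conformal
weights in the exponent cancel (`intExponent_eq`). What remains is an integer energy.

The core is an induction on `m` between `PathFormulas` and `FinalFormula`. Paths from `a` to `b`
that continue to `c` are counted by a power of `q` times `(q)_m F(m,r,b)`, with `r` one of
`[(b+1)/t]` and `[(b-1)/t]+1`, sometimes minus a correction of length `m-1`. Removing the last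
vertex of a path gives three terms, whereas the recurrences of `F` have a fourth, negative one at
`m-2`. That term is absorbed by the correction attached to one of the three steps onto `b`: the step
from below for label `1_A`, from above for `1_B`, the horizontal one for `2`. Conversely, one step
whose integer weight is off by one creates the correction for the next length. Condition (iv) on the
labels ensures that this step is itself counted by an uncorrected formula; the conditions near the
ends keep corrections away from the walls.

Finally, minimality of `Δ_{r,b}` says exactly that `r` is one of the two rows available at `b`
(`IsMinimizer.row_eq`). -/

namespace VirasoroPaths

noncomputable section

/-! ### Finitely supported sums as a relation -/

section HasFinsum

variable {α K : Type*} [Field K]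

/-- `f` has finite support and its sum is `v`. -/
def HasFinsum (f : α → K) (v : K) : Prop :=
  f.support.Finite ∧ ∑ᶠ x, f x = v

lemma HasFinsum.of_finite {f : α → K} (h : f.support.Finite) : HasFinsum f (∑ᶠ x, f x) :=
  ⟨h, rfl⟩

/-- The tool for summation identities: each side is assembled from shifted and scaled sums, and
`congr` leaves an identity between summands. -/
lemma HasFinsum.unique {f : α → K} {v w : K} (h : HasFinsum f v) (h' : HasFinsum f w) : v = w :=
  h.2.symm.trans h'.2

lemma HasFinsum.congr {f g : α → K} {v : K} (h : HasFinsum f v) (e : ∀ x, f x = g x) :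
    HasFinsum g v := by
  rwa [← funext e]

lemma HasFinsum.add {f g : α → K} {v w : K} (h : HasFinsum f v) (h' : HasFinsum g w) :
    HasFinsum (fun x => f x + g x) (v + w) := by
  refine ⟨(h.1.union h'.1).subset (Function.support_add f g), ?_⟩
  rw [finsum_add_distrib h.1 h'.1, h.2, h'.2]

lemma HasFinsum.mul_left {f : α → K} {v : K} (c : K) (h : HasFinsum f v) :
    HasFinsum (fun x => c * f x) (c * v) := by
  refine ⟨h.1.subset fun x hx => ?_, ?_⟩
  · exact right_ne_zero_of_mul hx
  · rw [← h.2, mul_finsum]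

lemma HasFinsum.sub {f g : α → K} {v w : K} (h : HasFinsum f v) (h' : HasFinsum g w) :
    HasFinsum (fun x => f x - g x) (v - w) := by
  have := h.add (h'.mul_left (-1))
  rw [sub_eq_add_neg, neg_eq_neg_one_mul]
  exact this.congr fun x => by ring

lemma HasFinsum.comp_equiv {β : Type*} {f : α → K} {v : K} (h : HasFinsum f v) (e : β ≃ α) :
    HasFinsum (fun x => f (e x)) v := by
  refine ⟨?_, ?_⟩
  · exact (h.1.preimage e.injective.injOn).subset fun x hx => hx
  · rw [finsum_comp_equiv e, h.2]

lemma HasFinsum.comp_add {f : ℤ → K} {v : K} (h : HasFinsum f v) (k : ℤ) :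
    HasFinsum (fun x => f (x + k)) v :=
  h.comp_equiv (Equiv.addRight k)

lemma HasFinsum.comp_neg {f : ℤ → K} {v : K} (h : HasFinsum f v) :
    HasFinsum (fun x => f (-x)) v :=
  h.comp_equiv (Equiv.neg ℤ)

/-- Reindexing along an injection that covers the support. -/
lemma HasFinsum.comp_injective {β : Type*} {f : α → K} {v : K} (h : HasFinsum f v) (g : β → α)
    (hg : Function.Injective g) (hf : ∀ x, f x ≠ 0 → x ∈ Set.range g) :
    HasFinsum (fun x => f (g x)) v := by
  refine ⟨(h.1.preimage hg.injOn).subset fun x hx => hx, ?_⟩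
  rw [← finsum_mem_range (f := f) hg, ← h.2]
  rw [← finsum_mem_univ f]
  exact finsum_mem_inter_support_eq' f _ _ fun x hx => iff_of_true (hf x hx) trivial

lemma HasFinsum.single {f : α → K} (x : α) (h : ∀ y, y ≠ x → f y = 0) : HasFinsum f (f x) := by
  refine ⟨(Set.finite_singleton x).subset fun y hy => ?_, finsum_eq_single f x h⟩
  by_contra hne
  exact hy (h y hne)

end HasFinsum

/-! ### The q-trinomial coefficients and their recurrences -/

section Trinomial

variable {K : Type*} [Field K]

lemma zpow_mul_zpow {q : K} (h0 : q ≠ 0) {a b c : ℤ} (h : a + b = c) : q ^ a * q ^ b = q ^ c := by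
  rw [← zpow_add₀ h0, h]

/-- `1 / (q)_n`, read as zero for negative `n`. -/
def invPoch (q : K) (n : ℤ) : K :=
  if 0 ≤ n then (qPoch q q n.toNat)⁻¹ else 0

lemma invPoch_of_neg (q : K) {n : ℤ} (h : n < 0) : invPoch q n = 0 :=
  if_neg (by omega)

lemma invPoch_natCast (q : K) (n : ℕ) : invPoch q n = (qPoch q q n)⁻¹ := by
  simp [invPoch]

lemma qPoch_self_succ (q : K) (n : ℕ) :
    qPoch q q (n + 1) = qPoch q q n * (1 - q ^ ((n : ℤ) + 1)) := by
  unfold qPoch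
  rw [Finset.prod_range_succ, ← pow_succ]
  norm_cast

/-- Because `1/(q)_n` is read as zero for negative `n`, no boundary cases arise in the termwise
identities: at `n = 0` both sides vanish. -/
lemma invPoch_sub_one {q : K} (hq : ∀ n : ℕ, 0 < n → q ^ n ≠ 1) (n : ℤ) :
    invPoch q (n - 1) = (1 - q ^ n) * invPoch q n := by
  rcases lt_trichotomy n 0 with h | h | h
  · rw [invPoch_of_neg q h, invPoch_of_neg q (by omega), mul_zero]
  · subst h
    rw [invPoch_of_neg q (by omega)]
    simp
  · obtain ⟨k, rfl⟩ : ∃ k : ℕ, n = (k : ℤ) + 1 := ⟨(n - 1).toNat, by omega⟩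
    have e : ((k : ℤ) + 1) = ((k + 1 : ℕ) : ℤ) := by push_cast; ring
    have h1 := qPoch_self_ne_zero hq k
    have h2 := qPoch_self_ne_zero hq (k + 1)
    rw [add_sub_cancel_right, e, invPoch_natCast, invPoch_natCast, ← e]
    rw [qPoch_self_succ] at h2 ⊢
    have h3 := right_ne_zero_of_mul h2
    field_simp

/-- The summand `q^{nm + 2ij} / ((q)_i (q)_j (q)_n)` with `i = j + l` and `i + j + n = m`. -/
def trinomialTerm (q : K) (m l j : ℤ) : K :=
  q ^ ((m - 2 * j - l) * m + 2 * (j + l) * j) *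
    (invPoch q (j + l) * invPoch q j * invPoch q (m - 2 * j - l))

lemma trinomialTerm_ne_zero {q : K} {m l j : ℤ} (h : trinomialTerm q m l j ≠ 0) :
    0 ≤ j ∧ 0 ≤ j + l ∧ 0 ≤ m - 2 * j - l := by
  refine ⟨?_, ?_, ?_⟩ <;>
  · by_contra hn
    apply h
    unfold trinomialTerm
    rw [invPoch_of_neg q (not_le.mp hn)]
    ring

/-- The coefficient `q^{m² - l²} S_{m,l}(q) / (q)_m`. -/
def trinomial (q : K) (m l : ℤ) : K :=
  ∑ᶠ j, trinomialTerm q m l j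

lemma hasFinsum_trinomial (q : K) (m l : ℤ) :
    HasFinsum (trinomialTerm q m l) (trinomial q m l) := by
  refine HasFinsum.of_finite ((Set.finite_Icc 0 (m - l)).subset fun j hj => ?_)
  have := trinomialTerm_ne_zero hj
  simp only [Set.mem_Icc]
  omega

lemma trinomial_ne_zero {q : K} {m l : ℤ} (h : trinomial q m l ≠ 0) : -m ≤ l ∧ l ≤ m := by
  obtain ⟨j, hj⟩ : ∃ j, trinomialTerm q m l j ≠ 0 := by
    by_contra! hn
    exact h (finsum_eq_zero_of_forall_eq_zero hn)
  have := trinomialTerm_ne_zero hj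
  omega

lemma trinomial_neg (q : K) (m l : ℤ) : trinomial q m (-l) = trinomial q m l := by
  refine ((hasFinsum_trinomial q m (-l)).comp_add l).unique
    ((hasFinsum_trinomial q m l).congr fun j => ?_)
  unfold trinomialTerm
  rw [show j + l + -l = j by ring, show m - 2 * (j + l) - -l = m - 2 * j - l by ring,
    mul_comm (invPoch q j)]
  congr 2
  ring

lemma trinomial_zero (q : K) (l : ℤ) : trinomial q 0 l = if l = 0 then 1 else 0 := by
  split_ifs with h
  · subst h
    have h1 : HasFinsum (trinomialTerm q 0 0) (trinomialTerm q 0 0 0) := by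
      refine HasFinsum.single 0 fun j hj => ?_
      by_contra hn
      have := trinomialTerm_ne_zero hn
      omega
    rw [(hasFinsum_trinomial q 0 0).unique h1]
    simp [trinomialTerm, invPoch, qPoch]
  · by_contra hn
    have := trinomial_ne_zero hn
    omega

/-- With `x, y, z` for `q^i, q^j, q^n`, the summands match by `1 - xyz = (1-x) + xy(1-z) + (1-y) -
(1-x)(1-y)`. -/
lemma trinomial_recurrence {q : K} (h0 : q ≠ 0) (hq : ∀ n : ℕ, 0 < n → q ^ n ≠ 1) (m l : ℤ) :
    (1 - q ^ m) * trinomial q m l =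
      q ^ (m - l) * trinomial q (m - 1) (l - 1) + q ^ (2 * m - 1) * trinomial q (m - 1) l +
      q ^ (m + l) * trinomial q (m - 1) (l + 1) - q ^ (2 * m - 2) * trinomial q (m - 2) l := by
  refine ((hasFinsum_trinomial q m l).mul_left (1 - q ^ m)).unique
    ((((((hasFinsum_trinomial q (m - 1) (l - 1)).mul_left (q ^ (m - l))).add
    ((hasFinsum_trinomial q (m - 1) l).mul_left (q ^ (2 * m - 1)))).add
    (((hasFinsum_trinomial q (m - 1) (l + 1)).comp_add (-1)).mul_left (q ^ (m + l)))).sub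
    (((hasFinsum_trinomial q (m - 2) l).comp_add (-1)).mul_left (q ^ (2 * m - 2)))).congr
    fun j => ?_)
  unfold trinomialTerm
  obtain ⟨n, rfl⟩ : ∃ n, m = n + 2 * j + l := ⟨m - 2 * j - l, by ring⟩
  obtain ⟨i, rfl⟩ : ∃ i, l = i - j := ⟨j + l, by ring⟩
  rw [show j + (i - j - 1) = i - 1 by ring,
    show n + 2 * j + (i - j) - 1 - 2 * j - (i - j - 1) = n by ring,
    show j + (i - j) = i by ring,
    show n + 2 * j + (i - j) - 1 - 2 * j - (i - j) = n - 1 by ring,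
    show j + -1 + (i - j + 1) = i by ring,
    show n + 2 * j + (i - j) - 1 - 2 * (j + -1) - (i - j + 1) = n by ring,
    show j + -1 + (i - j) = i - 1 by ring,
    show n + 2 * j + (i - j) - 2 - 2 * (j + -1) - (i - j) = n by ring,
    show n + 2 * j + (i - j) - 2 * j - (i - j) = n by ring,
    show j + -1 = j - 1 by ring,
    invPoch_sub_one hq i, invPoch_sub_one hq j, invPoch_sub_one hq n]
  set A := invPoch q i
  set B := invPoch q j
  set D := invPoch q n
  have e1 : q ^ (n + 2 * j + (i - j) - (i - j)) * q ^ (n * (n + 2 * j + (i - j) - 1) +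
    2 * (i - 1) * j) = q ^ (n * (n + 2 * j + (i - j)) + 2 * i * j) := zpow_mul_zpow h0 (by ring)
  have e2 : q ^ (2 * (n + 2 * j + (i - j)) - 1) * q ^ ((n - 1) * (n + 2 * j + (i - j) - 1) +
    2 * i * j) = q ^ (n * (n + 2 * j + (i - j)) + 2 * i * j) * (q ^ i * q ^ j) := by
    rw [zpow_mul_zpow h0 rfl, zpow_mul_zpow h0 rfl, zpow_mul_zpow h0 rfl]; congr 1; ring
  have e3 : q ^ (n + 2 * j + (i - j) + (i - j)) * q ^ (n * (n + 2 * j + (i - j) - 1) +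
    2 * i * (j - 1)) = q ^ (n * (n + 2 * j + (i - j)) + 2 * i * j) := zpow_mul_zpow h0 (by ring)
  have e4 : q ^ (2 * (n + 2 * j + (i - j)) - 2) * q ^ (n * (n + 2 * j + (i - j) - 2) +
    2 * (i - 1) * (j - 1)) = q ^ (n * (n + 2 * j + (i - j)) + 2 * i * j) :=
    zpow_mul_zpow h0 (by ring)
  have e5 : q ^ (n + 2 * j + (i - j)) = q ^ i * q ^ j * q ^ n := by
    rw [zpow_mul_zpow h0 rfl, zpow_mul_zpow h0 rfl]; congr 1; ring
  linear_combination (1 - q ^ i) * A * B * D * e1 + A * B * (1 - q ^ n) * D * e2 +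
    A * (1 - q ^ j) * B * D * e3 - (1 - q ^ i) * A * (1 - q ^ j) * B * D * e4 +
    q ^ (n * (n + 2 * j + (i - j)) + 2 * i * j) * A * B * D * e5

/-- The summand of the boundary terms in the telescoping proof of `trinomial_contiguous`. -/
def contiguousTerm (q : K) (m l j : ℤ) : K :=
  q ^ (1 + l + (j + l + 1) + (m - 2 * j - l - 1) * m + 2 * (j + l + 1) * j) *
    (invPoch q (j + l + 1) * invPoch q j * invPoch q (m - 2 * j - l - 2))

lemma hasFinsum_contiguousTerm (q : K) (m l : ℤ) :
    HasFinsum (contiguousTerm q m l) (∑ᶠ j, contiguousTerm q m l j) := by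
  refine HasFinsum.of_finite ((Set.finite_Icc 0 (m - l)).subset fun j hj => ?_)
  have h1 : 0 ≤ j := by
    by_contra hn
    exact hj (by rw [contiguousTerm, invPoch_of_neg q (not_le.mp hn)]; ring)
  have h2 : 0 ≤ m - 2 * j - l - 2 := by
    by_contra hn
    exact hj (by rw [contiguousTerm, invPoch_of_neg q (not_le.mp hn)]; ring)
  simp only [Set.mem_Icc]
  omega

/-- The summands do not match here; they differ by a difference of consecutive values of
`contiguousTerm`, which sums to zero. -/
lemma trinomial_contiguous {q : K} (h0 : q ≠ 0) (hq : ∀ n : ℕ, 0 < n → q ^ n ≠ 1) (m l : ℤ) :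
    q * (1 - q ^ m) * trinomial q m l - q ^ (m + 1 - l) * trinomial q (m - 1) (l - 1) +
      q ^ m * trinomial q (m - 1) l =
    q ^ (1 + l) * (1 - q ^ (m + 1 + l)) * trinomial q m (l + 1) := by
  have hL := (((hasFinsum_trinomial q m l).mul_left (q * (1 - q ^ m))).sub
    ((hasFinsum_trinomial q (m - 1) (l - 1)).mul_left (q ^ (m + 1 - l)))).add
    ((hasFinsum_trinomial q (m - 1) l).mul_left (q ^ m))
  have hR := (((hasFinsum_trinomial q m (l + 1)).mul_left
    (q ^ (1 + l) * (1 - q ^ (m + 1 + l)))).add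
    ((hasFinsum_contiguousTerm q m l).comp_add (-1))).sub (hasFinsum_contiguousTerm q m l)
  rw [add_sub_cancel_right] at hR
  refine hL.unique (hR.congr fun j => ?_)
  unfold trinomialTerm contiguousTerm
  obtain ⟨n, rfl⟩ : ∃ n, m = n + 2 * j + l := ⟨m - 2 * j - l, by ring⟩
  obtain ⟨i, rfl⟩ : ∃ i, l = i - j := ⟨j + l, by ring⟩
  have p1 : invPoch q i = (1 - q ^ (i + 1)) * invPoch q (i + 1) := by
    rw [← invPoch_sub_one hq, add_sub_cancel_right]
  have p2 : invPoch q (n - 2) = (1 - q ^ (n - 1)) * invPoch q (n - 1) := by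
    rw [← invPoch_sub_one hq]; congr 1; ring
  rw [show j + (i - j - 1) = i - 1 by ring,
    show n + 2 * j + (i - j) - 1 - 2 * j - (i - j - 1) = n by ring,
    show j + (i - j) = i by ring,
    show n + 2 * j + (i - j) - 1 - 2 * j - (i - j) = n - 1 by ring,
    show n + 2 * j + (i - j) - 2 * j - (i - j) = n by ring,
    show j + (i - j + 1) = i + 1 by ring,
    show n + 2 * j + (i - j) - 2 * j - (i - j + 1) = n - 1 by ring,
    show j + -1 + (i - j) + 1 = i by ring,
    show n + 2 * j + (i - j) - 2 * (j + -1) - (i - j) - 2 = n by ring,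
    show j + -1 = j - 1 by ring, p2,
    invPoch_sub_one hq i, p1, invPoch_sub_one hq j, invPoch_sub_one hq n]
  set A := invPoch q (i + 1)
  set B := invPoch q j
  set D := invPoch q n
  have w (a b : ℤ) : q ^ (a + b) = q ^ a * q ^ b := zpow_add₀ h0 a b
  set x := q ^ i with hx
  set y := q ^ j with hy
  set z := q ^ n with hz
  set E := q ^ (n * (n + 2 * j + (i - j)) + 2 * i * j) with hE
  obtain ⟨u, hu⟩ : ∃ u, u = q ^ (-n) := ⟨_, rfl⟩
  obtain ⟨v, hv⟩ : ∃ v, v = q ^ (n - 1) := ⟨_, rfl⟩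
  have hzu : z * u = 1 := by rw [hz, hu, ← w, add_neg_cancel, zpow_zero]
  have hzv : q * v = z := by
    rw [hz, hv]; nth_rw 1 [← zpow_one q]; rw [← w]; congr 1; ring
  have g0 : q ^ (i + 1) = q * x := by rw [w, zpow_one, mul_comm]
  have g1 : q ^ (1 + (i - j)) * q ^ ((n - 1) * (n + 2 * j + (i - j)) + 2 * (i + 1) * j) = q * u * E := by
    nth_rw 3 [← zpow_one q]; rw [hu, hE, ← w, ← w, ← w]; congr 1; ring
  have g2 : q ^ (n + 2 * j + (i - j) + 1 + (i - j)) = q * x * x * z := by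
    nth_rw 2 [← zpow_one q]; rw [hx, hz, ← w, ← w, ← w]; congr 1; ring
  have g3 : q ^ (1 + (i - j) + i + (n + 2 * j + (i - j) - 2 * (j - 1) - (i - j) - 1) * (n + 2 * j + (i - j)) +
      2 * i * (j - 1)) = q * x * z * E := by
    nth_rw 2 [← zpow_one q]; rw [hx, hz, hE, ← w, ← w, ← w]; congr 1; ring
  have g4 : q ^ (1 + (i - j) + (i + 1) + (n - 1) * (n + 2 * j + (i - j)) + 2 * (i + 1) * j) =
      q * q * x * u * E := by
    nth_rw 2 3 [← zpow_one q]; rw [hx, hu, hE, ← w, ← w, ← w, ← w]; congr 1; ring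
  have g6 : q ^ (n + 2 * j + (i - j)) = x * y * z := by
    rw [hx, hy, hz, ← w, ← w]; congr 1; ring
  have g7 : q ^ (n + 2 * j + (i - j) + 1 - (i - j)) * q ^ (n * (n + 2 * j + (i - j) - 1) + 2 * (i - 1) * j) = q * E := by
    nth_rw 3 [← zpow_one q]; rw [hE, ← w, ← w]; congr 1; ring
  have g8 : q ^ (n + 2 * j + (i - j)) * q ^ ((n - 1) * (n + 2 * j + (i - j) - 1) + 2 * i * j) = q * u * E := by
    nth_rw 3 [← zpow_one q]; rw [hu, hE, ← w, ← w, ← w]; congr 1; ring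
  rw [← hv, g0, g2, g3, g4]
  -- Each side is `q E A B D` times a polynomial in `q, x, y, z, u`; the two polynomials agree
  -- modulo `z u = 1`.
  trans q * E * A * B * D * ((1 - q * x * x * z) * u * (1 - z) +
    x * z * (1 - q * x) * (1 - y) - (q * x * u - x) * (1 - z))
  · linear_combination (1 - q * x * x * z) * (A * B * ((1 - z) * D)) * g1 +
      q * x * E * A * B * D * (1 - z) * (u * hzv + hzu)
  trans q * E * A * B * D * (1 - q * x) * ((1 - x * y * z) - (1 - x) + u * (1 - z))
  · linear_combination q * E * A * B * D * (1 - z) * (-q * x * x) * hzu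
  · rw [← g6]
    linear_combination (1 - x) * ((1 - q * x) * A) * B * D * g7 -
      (1 - q * x) * A * B * ((1 - z) * D) * g8

/-- Subtracting `q^(m-1)` times the contiguous relation at `m-1` from the symmetric recurrence moves
the negative term from `l` to `l-1`. This one-sided form is needed at vertices with label `2`. -/
lemma trinomial_recurrence' {q : K} (h0 : q ≠ 0) (hq : ∀ n : ℕ, 0 < n → q ^ n ≠ 1) (m l : ℤ) :
    (1 - q ^ m) * trinomial q m l =
      q ^ (m - l) * trinomial q (m - 1) (l - 1) + q ^ m * trinomial q (m - 1) l -
      q ^ (2 * m - 1 - l) * trinomial q (m - 2) (l - 1) +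
      q ^ (2 * m + 2 * l) * trinomial q (m - 1) (l + 1) := by
  have h1 := trinomial_recurrence h0 hq m l
  have h2 := trinomial_contiguous h0 hq (m - 1) l
  rw [show m - 1 + 1 - l = m - l by ring, show m - 1 - 1 = m - 2 by ring,
    show m - 1 + 1 + l = m + l by ring] at h2
  have e1 : q ^ (m - 1) * q = q ^ m := by rw [← zpow_add_one₀ h0, sub_add_cancel]
  have e2 : q ^ m * q ^ (m - 1) = q ^ (2 * m - 1) := zpow_mul_zpow h0 (by ring)
  have e3 : q ^ (m - 1) * q ^ (m - l) = q ^ (2 * m - 1 - l) := zpow_mul_zpow h0 (by ring)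
  have e4 : q ^ (m - 1) * q ^ (m - 1) = q ^ (2 * m - 2) := zpow_mul_zpow h0 (by ring)
  have e5 : q ^ (m - 1) * q ^ (1 + l) = q ^ (m + l) := zpow_mul_zpow h0 (by ring)
  have e6 : q ^ (m + l) * q ^ (m + l) = q ^ (2 * m + 2 * l) := zpow_mul_zpow h0 (by ring)
  linear_combination h1 - q ^ (m - 1) * h2 -
    (q ^ (m - 1) - 1) * trinomial q (m - 1) l * e1 - trinomial q (m - 1) l * e2 -
    trinomial q (m - 2) (l - 1) * e3 + trinomial q (m - 2) l * e4 -
    (1 - q ^ (m + l)) * trinomial q (m - 1) (l + 1) * e5 + trinomial q (m - 1) (l + 1) * e6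

lemma qBinom_natCast {q : K} (h0 : q ≠ 0) (hq : ∀ n : ℕ, 0 < n → q ^ n ≠ 1) (n : ℕ) (k : ℤ) :
    qBinom q n k = qPoch q q n * invPoch q k * invPoch q (n - k) := by
  by_cases h1 : k < 0
  · rw [qBinom_of_neg q n k h1, invPoch_of_neg q h1]; ring
  by_cases h2 : (n : ℤ) < k
  · rw [qBinom_of_lt h0 n k (by omega) h2, invPoch_of_neg q (by omega : (n : ℤ) - k < 0)]; ring
  obtain ⟨k, rfl⟩ := Int.eq_ofNat_of_zero_le (not_lt.mp h1)
  obtain ⟨d, hd⟩ := Int.eq_ofNat_of_zero_le (sub_nonneg.mpr (not_lt.mp h2))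
  have e : (n : ℤ) = (k : ℤ) + d := by omega
  rw [hd, e, qBinom_of_add hq, invPoch_natCast, invPoch_natCast, show n = d + k by omega]
  field_simp

/-- `q^{m² - l²} S_{m,l}(q) = (q)_m t_{m,l}(q)`. -/
lemma zpow_mul_S {q : K} (h0 : q ≠ 0) (hq : ∀ n : ℕ, 0 < n → q ^ n ≠ 1) (m : ℕ) (l : ℤ) :
    q ^ ((m : ℤ) ^ 2 - l ^ 2) * S q m l = qPoch q q m * trinomial q m l := by
  -- The substitution `j = m-l-ν` gives `i = m-ν` and `n = ν-(m-l-ν)`.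
  have h := (hasFinsum_trinomial q m l).comp_equiv (Equiv.subLeft ((m : ℤ) - l))
  have h' := h.mul_left (qPoch q q m * q ^ (l ^ 2 - (m : ℤ) ^ 2))
  have key : S q m l = qPoch q q m * q ^ (l ^ 2 - (m : ℤ) ^ 2) * trinomial q m l := by
    rw [S_eq h0 hq, ← h'.2]
    refine finsum_congr fun ν => ?_
    simp only [Equiv.subLeft_apply, trinomialTerm]
    rw [show (m : ℤ) - l - ν + l = m - ν by ring,
      show (m : ℤ) - 2 * (m - l - ν) - l = ν - (m - l - ν) by ring]
    have e : q ^ ((ν + l - m) * (ν + l) + ν * (ν - m)) = q ^ (l ^ 2 - (m : ℤ) ^ 2) *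
        q ^ ((ν - (m - l - ν)) * (m : ℤ) + 2 * (m - ν) * (m - l - ν)) := by
      rw [zpow_mul_zpow h0 rfl]; congr 1; ring
    rw [e, qBinom_natCast h0 hq m ν]
    by_cases hν : ν < 0
    · have : invPoch q (m - l - ν) * invPoch q (ν - (m - l - ν)) = 0 := by
        by_cases h3 : (m - l - ν : ℤ) < 0
        · rw [invPoch_of_neg q h3, zero_mul]
        · rw [invPoch_of_neg q (by omega : ν - (m - l - ν) < 0), mul_zero]
      rw [invPoch_of_neg q hν]
      linear_combination (-(qPoch q q m * q ^ (l ^ 2 - (m : ℤ) ^ 2) *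
        q ^ ((ν - (m - l - ν)) * (m : ℤ) + 2 * (m - ν) * (m - l - ν)) * invPoch q (m - ν))) * this
    · obtain ⟨n, rfl⟩ := Int.eq_ofNat_of_zero_le (not_lt.mp hν)
      have := qPoch_self_ne_zero hq n
      rw [qBinom_natCast h0 hq n, invPoch_natCast q n]
      field_simp
  have e : q ^ ((m : ℤ) ^ 2 - l ^ 2) * q ^ (l ^ 2 - (m : ℤ) ^ 2) = 1 := by
    rw [zpow_mul_zpow h0 (c := 0) (by ring), zpow_zero]
  rw [key]
  linear_combination qPoch q q m * trinomial q m l * e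

end Trinomial

/-! ### Image sums, their recurrences and their behaviour at the walls -/

section ImageSum

variable {K : Type*} [Field K]

/-- The sum over `l` of `C (b + 2 l) q^{-r l} t_{m,l}(q)`. -/
def imageSum (q : K) (C : ℤ → K) (m r b : ℤ) : K :=
  ∑ᶠ l, C (b + 2 * l) * q ^ (-r * l) * trinomial q m l

lemma hasFinsum_imageSum (q : K) (C : ℤ → K) (m r b : ℤ) :
    HasFinsum (fun l => C (b + 2 * l) * q ^ (-r * l) * trinomial q m l) (imageSum q C m r b) := by
  refine HasFinsum.of_finite ((Set.finite_Icc (-m) m).subset fun l hl => ?_)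
  exact trinomial_ne_zero (right_ne_zero_of_mul hl)

lemma imageSum_zero (q : K) (C : ℤ → K) (r b : ℤ) : imageSum q C 0 r b = C b := by
  refine (hasFinsum_imageSum q C 0 r b).unique ?_
  have h : HasFinsum (fun l => C (b + 2 * l) * q ^ (-r * l) * trinomial q 0 l)
      (C (b + 2 * 0) * q ^ (-r * 0) * trinomial q 0 0) :=
    HasFinsum.single (f := fun l => C (b + 2 * l) * q ^ (-r * l) * trinomial q 0 l) 0
      fun l hl => by simp [trinomial_zero, hl]
  simpa [trinomial_zero] using h

lemma imageSum_of_neg (q : K) (C : ℤ → K) {m : ℤ} (hm : m < 0) (r b : ℤ) :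
    imageSum q C m r b = 0 := by
  refine finsum_eq_zero_of_forall_eq_zero fun l => ?_
  by_contra h
  have := trinomial_ne_zero (right_ne_zero_of_mul h)
  omega

/-- A shift of `l` moves `b` by two, and the factors `q^(±l)` of the trinomial recurrence move the
row `r` by one. -/
lemma imageSum_recurrence {q : K} (h0 : q ≠ 0) (hq : ∀ n : ℕ, 0 < n → q ^ n ≠ 1) (C : ℤ → K)
    (m r b : ℤ) :
    (1 - q ^ m) * imageSum q C m r b =
      q ^ (m - r - 1) * imageSum q C (m - 1) (r + 1) (b + 2) +
      q ^ (2 * m - 1) * imageSum q C (m - 1) r b +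
      q ^ (m + r - 1) * imageSum q C (m - 1) (r - 1) (b - 2) -
      q ^ (2 * m - 2) * imageSum q C (m - 2) r b := by
  refine ((hasFinsum_imageSum q C m r b).mul_left (1 - q ^ m)).unique
    (((((((hasFinsum_imageSum q C (m - 1) (r + 1) (b + 2)).comp_add (-1)).mul_left
      (q ^ (m - r - 1))).add
    ((hasFinsum_imageSum q C (m - 1) r b).mul_left (q ^ (2 * m - 1)))).add
    (((hasFinsum_imageSum q C (m - 1) (r - 1) (b - 2)).comp_add 1).mul_left
      (q ^ (m + r - 1)))).sub
    ((hasFinsum_imageSum q C (m - 2) r b).mul_left (q ^ (2 * m - 2)))).congr fun l => ?_)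
  have e1 : q ^ (m - r - 1) * q ^ (-(r + 1) * (l + -1)) = q ^ (-r * l) * q ^ (m - l) := by
    rw [zpow_mul_zpow h0 rfl, zpow_mul_zpow h0 rfl]; congr 1; ring
  have e2 : q ^ (m + r - 1) * q ^ (-(r - 1) * (l + 1)) = q ^ (-r * l) * q ^ (m + l) := by
    rw [zpow_mul_zpow h0 rfl, zpow_mul_zpow h0 rfl]; congr 1; ring
  rw [show b + 2 + 2 * (l + -1) = b + 2 * l by ring, show b - 2 + 2 * (l + 1) = b + 2 * l by ring,
    show l + -1 = l - 1 by ring] at *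
  linear_combination C (b + 2 * l) * trinomial q (m - 1) (l - 1) * e1 +
    C (b + 2 * l) * trinomial q (m - 1) (l + 1) * e2 -
    C (b + 2 * l) * q ^ (-r * l) * trinomial_recurrence h0 hq m l

/-- The factor `q^(2l)` moves the row by two, matching a jump of two in `[x/t]` where `τ = 2`. -/
lemma imageSum_recurrence_right {q : K} (h0 : q ≠ 0) (hq : ∀ n : ℕ, 0 < n → q ^ n ≠ 1)
    (C : ℤ → K) (m r b : ℤ) :
    (1 - q ^ m) * imageSum q C m r b =
      q ^ (m - r - 1) * imageSum q C (m - 1) (r + 1) (b + 2) +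
      q ^ m * imageSum q C (m - 1) r b -
      q ^ (2 * m - 2 - r) * imageSum q C (m - 2) (r + 1) (b + 2) +
      q ^ (2 * m + r - 2) * imageSum q C (m - 1) (r - 2) (b - 2) := by
  refine ((hasFinsum_imageSum q C m r b).mul_left (1 - q ^ m)).unique
    (((((((hasFinsum_imageSum q C (m - 1) (r + 1) (b + 2)).comp_add (-1)).mul_left
      (q ^ (m - r - 1))).add
    ((hasFinsum_imageSum q C (m - 1) r b).mul_left (q ^ m))).sub
    (((hasFinsum_imageSum q C (m - 2) (r + 1) (b + 2)).comp_add (-1)).mul_left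
      (q ^ (2 * m - 2 - r)))).add
    (((hasFinsum_imageSum q C (m - 1) (r - 2) (b - 2)).comp_add 1).mul_left
      (q ^ (2 * m + r - 2)))).congr fun l => ?_)
  have e1 : q ^ (m - r - 1) * q ^ (-(r + 1) * (l + -1)) = q ^ (-r * l) * q ^ (m - l) := by
    rw [zpow_mul_zpow h0 rfl, zpow_mul_zpow h0 rfl]; congr 1; ring
  have e2 : q ^ (2 * m - 2 - r) * q ^ (-(r + 1) * (l + -1)) =
      q ^ (-r * l) * q ^ (2 * m - 1 - l) := by
    rw [zpow_mul_zpow h0 rfl, zpow_mul_zpow h0 rfl]; congr 1; ring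
  have e3 : q ^ (2 * m + r - 2) * q ^ (-(r - 2) * (l + 1)) =
      q ^ (-r * l) * q ^ (2 * m + 2 * l) := by
    rw [zpow_mul_zpow h0 rfl, zpow_mul_zpow h0 rfl]; congr 1; ring
  rw [show b + 2 + 2 * (l + -1) = b + 2 * l by ring, show b - 2 + 2 * (l + 1) = b + 2 * l by ring,
    show l + -1 = l - 1 by ring] at *
  linear_combination C (b + 2 * l) * trinomial q (m - 1) (l - 1) * e1 -
    C (b + 2 * l) * trinomial q (m - 2) (l - 1) * e2 +
    C (b + 2 * l) * trinomial q (m - 1) (l + 1) * e3 -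
    C (b + 2 * l) * q ^ (-r * l) * trinomial_recurrence' h0 hq m l

/-- The reflection `x ↦ 2 c - x` of the coefficients. -/
lemma imageSum_reflect {q : K} (h0 : q ≠ 0) {C : ℤ → K} {c d e : ℤ}
    (hC : ∀ x, C (2 * c - x) = -q ^ (d * (e - x)) * C x) (m r b : ℤ) :
    imageSum q C m (2 * d - r) (2 * c - b) = -q ^ (d * (e - b)) * imageSum q C m r b := by
  refine ((hasFinsum_imageSum q C m (2 * d - r) (2 * c - b)).comp_neg).unique
    (((hasFinsum_imageSum q C m r b).mul_left (-q ^ (d * (e - b)))).congr fun l => ?_)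
  have e1 : q ^ (d * (e - (b + 2 * l))) * q ^ (-(2 * d - r) * -l) =
      q ^ (d * (e - b)) * q ^ (-r * l) := by
    rw [zpow_mul_zpow h0 rfl, zpow_mul_zpow h0 rfl]; congr 1; ring
  rw [show 2 * c - b + 2 * -l = 2 * c - (b + 2 * l) by ring, hC, trinomial_neg]
  linear_combination C (b + 2 * l) * trinomial q m l * e1

lemma imageSum_comp_neg (q : K) (C : ℤ → K) (m r b : ℤ) :
    imageSum q (fun x => C (-x)) m r b = imageSum q C m (-r) (-b) := by
  refine (hasFinsum_imageSum q _ m r b).unique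
    ((hasFinsum_imageSum q C m (-r) (-b)).comp_neg.congr fun l => ?_)
  rw [trinomial_neg, show - -r * -l = -r * l by ring, show -b + 2 * -l = -(b + 2 * l) by ring]

/-- The mirror image of the right-hand form, obtained from it for the coefficients `x ↦ C(-x)`. -/
lemma imageSum_recurrence_left {q : K} (h0 : q ≠ 0) (hq : ∀ n : ℕ, 0 < n → q ^ n ≠ 1)
    (C : ℤ → K) (m r b : ℤ) :
    (1 - q ^ m) * imageSum q C m r b =
      q ^ (m + r - 1) * imageSum q C (m - 1) (r - 1) (b - 2) +
      q ^ m * imageSum q C (m - 1) r b -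
      q ^ (2 * m - 2 + r) * imageSum q C (m - 2) (r - 1) (b - 2) +
      q ^ (2 * m - 2 - r) * imageSum q C (m - 1) (r + 2) (b + 2) := by
  have h := imageSum_recurrence_right h0 hq (fun x => C (-x)) m (-r) (-b)
  simp only [imageSum_comp_neg, neg_neg] at h
  rw [show m - -r - 1 = m + r - 1 by ring, show -(-r + 1) = r - 1 by ring,
    show -(-b + 2) = b - 2 by ring, show 2 * m - 2 - -r = 2 * m - 2 + r by ring,
    show 2 * m + -r - 2 = 2 * m - 2 - r by ring, show -(-r - 2) = r + 2 by ring,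
    show -(-b - 2) = b + 2 by ring] at h
  exact h

/-- A coefficient function that is antisymmetric with respect to the reflections in `0` and `p'`. -/
structure IsAntisymmetric (q : K) (p p' : ℤ) (C : ℤ → K) : Prop where
  neg : ∀ x, C (-x) = -C x
  reflect : ∀ x, C (2 * p' - x) = -q ^ (p * (p' - x)) * C x

variable {q : K} {p p' : ℤ} {C : ℤ → K}

lemma IsAntisymmetric.imageSum_neg (hC : IsAntisymmetric q p p' C) (h0 : q ≠ 0) (m r b : ℤ) :
    imageSum q C m (-r) (-b) = -imageSum q C m r b := by
  have := imageSum_reflect h0 (c := 0) (d := 0) (e := 0) (C := C)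
    (fun x => by simpa using hC.neg x) m r b
  simpa using this

lemma IsAntisymmetric.imageSum_reflect (hC : IsAntisymmetric q p p' C) (h0 : q ≠ 0) (m r b : ℤ) :
    imageSum q C m (2 * p - r) (2 * p' - b) = -q ^ (p * (p' - b)) * imageSum q C m r b :=
  VirasoroPaths.imageSum_reflect h0 hC.reflect m r b

/-- The point `(0,0)` is fixed by the reflection, so the sum equals its own negative. -/
lemma IsAntisymmetric.imageSum_zero_zero [CharZero K] (hC : IsAntisymmetric q p p' C)
    (h0 : q ≠ 0) (m : ℤ) : imageSum q C m 0 0 = 0 := by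
  have := hC.imageSum_neg h0 m 0 0
  rw [neg_zero] at this
  exact self_eq_neg.mp this

lemma IsAntisymmetric.imageSum_wall [CharZero K] (hC : IsAntisymmetric q p p' C)
    (h0 : q ≠ 0) (m : ℤ) : imageSum q C m p p' = 0 := by
  have := hC.imageSum_reflect h0 m p p'
  rw [two_mul, two_mul, add_sub_cancel_right, add_sub_cancel_right, sub_self, mul_zero,
    zpow_zero, neg_one_mul] at this
  exact self_eq_neg.mp this

/-- Next to the wall `0` only one term of the recurrence survives. -/
lemma IsAntisymmetric.imageSum_one (hC : IsAntisymmetric q p p' C) (h0 : q ≠ 0)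
    (hq : ∀ n : ℕ, 0 < n → q ^ n ≠ 1) (m : ℕ) :
    (1 - q ^ ((m : ℤ) + 1)) * imageSum q C (m + 1) 1 1 =
      q ^ ((m : ℤ) - 1) * imageSum q C m 2 3 := by
  induction m with
  | zero =>
    have h := imageSum_recurrence_right h0 hq C 1 1 1
    rw [imageSum_of_neg q C (by omega : (1 : ℤ) - 2 < 0)] at h
    norm_num at h ⊢
    have h2 := hC.imageSum_neg h0 0 1 1
    rw [h2] at h
    linear_combination h
  | succ k ih =>
    push_cast
    -- Antisymmetry turns the value at `(-1,-1)` into minus the value at `(1,1)`. By the induction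
    -- hypothesis times `q^(k+2)`, all terms on the right except the first then cancel.
    have h := imageSum_recurrence_right h0 hq C (k + 1 + 1) 1 1
    have h2 := hC.imageSum_neg h0 (k + 1) 1 1
    rw [show ((k : ℤ) + 1 + 1 - 1) = k + 1 by ring, show ((k : ℤ) + 1 + 1 - 2) = k by ring,
      show (1 : ℤ) + 1 = 2 by norm_num, show (1 : ℤ) + 2 = 3 by norm_num,
      show (1 : ℤ) - 2 = -1 by norm_num, h2] at h
    rw [show ((k : ℤ) + 1 - 1) = k by ring, show (k : ℤ) + 1 + 1 = k + 2 by ring] at *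
    have e1 : q ^ ((k : ℤ) + 2) * q ^ ((k : ℤ) + 1) = q ^ (2 * ((k : ℤ) + 2) + 1 - 2) :=
      zpow_mul_zpow h0 (by ring)
    have e2 : q ^ ((k : ℤ) + 2) * q ^ ((k : ℤ) - 1) = q ^ (2 * ((k : ℤ) + 2) - 2 - 1) :=
      zpow_mul_zpow h0 (by ring)
    linear_combination h + q ^ ((k : ℤ) + 2) * ih + imageSum q C (k + 1) 1 1 * e1 +
      imageSum q C k 2 3 * e2

/-- Next to the wall `p'` only one term of the recurrence survives. -/
lemma IsAntisymmetric.imageSum_last (hC : IsAntisymmetric q p p' C) (h0 : q ≠ 0)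
    (hq : ∀ n : ℕ, 0 < n → q ^ n ≠ 1) (m : ℕ) :
    (1 - q ^ ((m : ℤ) + 1)) * imageSum q C (m + 1) (p - 1) (p' - 1) =
      q ^ ((m : ℤ) + (p - 1)) * imageSum q C m (p - 2) (p' - 3) := by
  -- Reflection relates the last point before the wall to `(p+1, p'+1)` across it, which occurs in
  -- the left recurrence.
  have hr (n : ℤ) := hC.imageSum_reflect h0 n (p - 1) (p' - 1)
  rw [show 2 * p - (p - 1) = p - 1 + 2 by ring, show 2 * p' - (p' - 1) = p' - 1 + 2 by ring,
    show p * (p' - (p' - 1)) = p by ring] at hr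
  induction m with
  | zero =>
    have h := imageSum_recurrence_left h0 hq C 1 (p - 1) (p' - 1)
    rw [imageSum_of_neg q C (by omega : (1 : ℤ) - 2 < 0), hr] at h
    have e1 : q ^ (2 * 1 - 2 - (p - 1)) * q ^ p = q := by
      rw [zpow_mul_zpow h0 (c := 1) (by ring), zpow_one]
    rw [show p - 1 - 1 = p - 2 by ring, show p' - 1 - 2 = p' - 3 by ring,
      show 1 + (p - 1) - 1 = p - 1 by ring, zpow_one] at h
    simp only [Nat.cast_zero, zero_add, zpow_one]
    norm_num at h e1 ⊢
    linear_combination h - imageSum q C 0 (p - 1) (p' - 1) * e1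
  | succ k ih =>
    push_cast
    have h := imageSum_recurrence_left h0 hq C (k + 2) (p - 1) (p' - 1)
    rw [show ((k : ℤ) + 2 - 1) = k + 1 by ring, show ((k : ℤ) + 2 - 2) = k by ring,
      show p - 1 - 1 = p - 2 by ring, show p' - 1 - 2 = p' - 3 by ring, hr,
      show (k : ℤ) + 2 + (p - 1) - 1 = k + 1 + (p - 1) by ring] at h
    rw [show (k : ℤ) + 1 + 1 = k + 2 by ring]
    have e1 : q ^ ((k : ℤ) + 2) * q ^ ((k : ℤ) + 1) =
        q ^ (2 * ((k : ℤ) + 2) - 2 - (p - 1)) * q ^ p := by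
      rw [zpow_mul_zpow h0 rfl, zpow_mul_zpow h0 rfl]; congr 1; ring
    have e2 : q ^ ((k : ℤ) + 2) * q ^ ((k : ℤ) + (p - 1)) =
        q ^ (2 * ((k : ℤ) + 2) - 2 + (p - 1)) := zpow_mul_zpow h0 (by ring)
    linear_combination h + q ^ ((k : ℤ) + 2) * ih + imageSum q C (k + 1) (p - 1) (p' - 1) * e1 +
      imageSum q C k (p - 2) (p' - 3) * e2

end ImageSum

/-! ### The alternating sum as an image sum -/

section ImageCoeff

variable {K : Type*} [Field K]

/-- The coefficient `q^{k² p p' - k p a}` at `x = a - 2 p' k`, and zero at all other `x`. -/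
def translateCoeff (q : K) (p p' : ℕ) (a x : ℤ) : K :=
  if 2 * (p' : ℤ) ∣ a - x then
    q ^ (((a - x) / (2 * p')) ^ 2 * p * p' - (a - x) / (2 * p') * (p * a))
  else 0

lemma translateCoeff_apply (q : K) (p : ℕ) {p' : ℕ} (hp' : 0 < p') (a k : ℤ) :
    translateCoeff q p p' a (a - 2 * p' * k) = q ^ (k ^ 2 * p * p' - k * (p * a)) := by
  have e : a - (a - 2 * p' * k) = 2 * p' * k := by ring
  unfold translateCoeff
  rw [e, if_pos (dvd_mul_right _ _), Int.mul_ediv_cancel_left _ (by positivity)]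

lemma exists_of_translateCoeff_ne_zero {q : K} {p p' : ℕ} {a x : ℤ}
    (h : translateCoeff q p p' a x ≠ 0) : ∃ k, x = a - 2 * p' * k := by
  unfold translateCoeff at h
  split_ifs at h with hd
  · obtain ⟨k, hk⟩ := hd
    exact ⟨k, by linarith⟩
  · exact absurd rfl h

/-- Translation by `2p'` lowers `k` by one. Together with the reflection in `0` this
quasi-periodicity gives the reflection in `p'`. -/
lemma translateCoeff_add {q : K} (h0 : q ≠ 0) (p : ℕ) {p' : ℕ} (hp' : 0 < p') (a x : ℤ) :
    translateCoeff q p p' a (x + 2 * p') =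
      q ^ ((p * p' + p * x : ℤ)) * translateCoeff q p p' a x := by
  by_cases h : ∃ k, x = a - 2 * p' * k
  · obtain ⟨k, rfl⟩ := h
    rw [show a - 2 * p' * k + 2 * p' = a - 2 * p' * (k - 1) by ring, translateCoeff_apply q p hp',
      translateCoeff_apply q p hp', zpow_mul_zpow h0 rfl]
    congr 1
    ring
  · have h1 : translateCoeff q p p' a x = 0 := by
      by_contra hn
      exact h (exists_of_translateCoeff_ne_zero hn)
    rw [h1, mul_zero]
    by_contra hn
    obtain ⟨k, hk⟩ := exists_of_translateCoeff_ne_zero hn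
    exact h ⟨k + 1, by linarith⟩

/-- The alternating coefficients on the images of `a` under the affine Weyl group. -/
def imageCoeff (q : K) (p p' : ℕ) (a x : ℤ) : K :=
  translateCoeff q p p' a x - translateCoeff q p p' a (-x)

lemma isAntisymmetric_imageCoeff {q : K} (h0 : q ≠ 0) (p : ℕ) {p' : ℕ} (hp' : 0 < p') (a : ℤ) :
    IsAntisymmetric q p p' (imageCoeff q p p' a) where
  neg x := by
    unfold imageCoeff
    rw [neg_neg]
    ring
  reflect x := by
    unfold imageCoeff
    have h1 := translateCoeff_add h0 p hp' a (-x)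
    have h2 := translateCoeff_add h0 p hp' a (x - 2 * p')
    rw [sub_add_cancel] at h2
    rw [show 2 * (p' : ℤ) - x = -x + 2 * p' by ring, h1, h2,
      show -(-x + 2 * (p' : ℤ)) = x - 2 * p' by ring]
    have e : q ^ ((p : ℤ) * (p' - x)) * q ^ ((p : ℤ) * p' + p * (x - 2 * p')) = 1 := by
      rw [zpow_mul_zpow h0 (c := 0) (by ring), zpow_zero]
    rw [show (p : ℤ) * p' + p * -x = p * (p' - x) by ring]
    linear_combination translateCoeff q p p' a (x - 2 * p') * e

/-- The open strip between the walls contains no image of `a` other than `a` itself. -/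
lemma imageCoeff_of_mem (q : K) (p : ℕ) {p' : ℕ} {a b : ℤ} (ha : 1 ≤ a) (ha' : a ≤ p' - 1)
    (hb : 1 ≤ b) (hb' : b ≤ p' - 1) : imageCoeff q p p' a b = if a = b then 1 else 0 := by
  have hp' : 0 < p' := by omega
  have h2 : translateCoeff q p p' a (-b) = 0 := by
    unfold translateCoeff
    rw [if_neg]
    intro hd
    have := Int.le_of_dvd (by omega) hd
    omega
  unfold imageCoeff
  rw [h2, sub_zero]
  split_ifs with h
  · subst h
    simpa using translateCoeff_apply q p hp' a 0
  · unfold translateCoeff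
    rw [if_neg]
    intro hd
    rw [← dvd_abs] at hd
    have := Int.le_of_dvd (abs_pos.mpr (sub_ne_zero.mpr h)) hd
    rcases abs_cases (a - b) with h | h <;> omega

/-- Substitute `l = β - p'k`, so that `b + 2l = a - 2p'k`; all other `l` have coefficient zero. -/
lemma finsum_translate_eq {q : K} (h0 : q ≠ 0) (hq : ∀ n : ℕ, 0 < n → q ^ n ≠ 1) (p : ℕ)
    {p' : ℕ} (hp' : 0 < p') (r a b β : ℤ) (ha : a = b + 2 * β) (m : ℕ) :
    ∑ᶠ k : ℤ, q ^ (k ^ 2 * p * p' + k * (p' * r - p * a) + m ^ 2 - (β - p' * k) ^ 2) *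
      S q m (β - p' * k) =
    qPoch q q m * q ^ (r * β) * imageSum q (translateCoeff q p p' a) m r b := by
  have hpz : (p' : ℤ) ≠ 0 := by positivity
  have hinj : Function.Injective (fun k : ℤ => β - p' * k) := fun x y h => by
    have h' : (p' : ℤ) * x = p' * y := by simp only [] at h; linarith
    exact mul_left_cancel₀ hpz h'
  have h := (hasFinsum_imageSum q (translateCoeff q p p' a) m r b).comp_injective _ hinj
    (fun l hl => by
      obtain ⟨k, hk⟩ :=
        exists_of_translateCoeff_ne_zero (left_ne_zero_of_mul (left_ne_zero_of_mul hl))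
      exact ⟨k, by simp only []; linarith⟩)
  rw [← (h.mul_left (qPoch q q m * q ^ (r * β))).2]
  refine finsum_congr fun k => ?_
  beta_reduce
  have t := zpow_mul_S h0 hq m (β - p' * k)
  rw [show b + 2 * (β - p' * k) = a - 2 * p' * k by rw [ha]; ring, translateCoeff_apply q p hp']
  have e : q ^ (k ^ 2 * p * p' + k * (p' * r - p * a) + (m : ℤ) ^ 2 - (β - p' * k) ^ 2) =
      q ^ (r * β) * (q ^ (k ^ 2 * p * p' - k * (p * a)) * q ^ (-r * (β - p' * k))) *
        q ^ ((m : ℤ) ^ 2 - (β - p' * k) ^ 2) := by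
    rw [← zpow_add₀ h0, ← zpow_add₀ h0, ← zpow_add₀ h0]; congr 1; ring
  rw [e]
  linear_combination q ^ (r * β) * (q ^ (k ^ 2 * p * p' - k * (p * a)) *
    q ^ (-r * (β - p' * k))) * t

/-- Here `l = -(b + β + p'k)`, so that `-(b + 2l) = a + 2p'k`; the sign of `l` is harmless because
`T(m,l)` is even in `l`. -/
lemma finsum_reflect_eq {q : K} (h0 : q ≠ 0) (hq : ∀ n : ℕ, 0 < n → q ^ n ≠ 1) (p : ℕ)
    {p' : ℕ} (hp' : 0 < p') (r a b β : ℤ) (ha : a = b + 2 * β) (m : ℕ) :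
    ∑ᶠ k : ℤ, q ^ (k ^ 2 * p * p' + k * (p' * r + p * a) + r * a + m ^ 2 -
        (b + β + p' * k) ^ 2) * S q m (b + β + p' * k) =
    qPoch q q m * q ^ (r * β) * imageSum q (fun x => translateCoeff q p p' a (-x)) m r b := by
  have hpz : (p' : ℤ) ≠ 0 := by positivity
  have hinj : Function.Injective (fun k : ℤ => -(b + β + p' * k)) := fun x y h => by
    have h' : (p' : ℤ) * x = p' * y := by simp only [] at h; linarith
    exact mul_left_cancel₀ hpz h'
  have h := (hasFinsum_imageSum q (fun x => translateCoeff q p p' a (-x)) m r b).comp_injective _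
    hinj (fun l hl => by
      obtain ⟨k, hk⟩ :=
        exists_of_translateCoeff_ne_zero (left_ne_zero_of_mul (left_ne_zero_of_mul hl))
      exact ⟨-k, by simp only []; linarith⟩)
  rw [← (h.mul_left (qPoch q q m * q ^ (r * β))).2]
  refine finsum_congr fun k => ?_
  beta_reduce
  have t := zpow_mul_S h0 hq m (b + β + p' * k)
  rw [show -(b + 2 * -(b + β + p' * k)) = a - 2 * p' * -k by rw [ha]; ring,
    translateCoeff_apply q p hp', trinomial_neg]
  have e : q ^ (k ^ 2 * p * p' + k * (p' * r + p * a) + r * a + (m : ℤ) ^ 2 -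
        (b + β + p' * k) ^ 2) =
      q ^ (r * β) * (q ^ ((-k) ^ 2 * p * p' - -k * (p * a)) *
        q ^ (-r * -(b + β + p' * k))) * q ^ ((m : ℤ) ^ 2 - (b + β + p' * k) ^ 2) := by
    rw [← zpow_add₀ h0, ← zpow_add₀ h0, ← zpow_add₀ h0]; congr 1; rw [ha]; ring
  rw [e]
  linear_combination q ^ (r * β) * (q ^ ((-k) ^ 2 * p * p' - -k * (p * a)) *
    q ^ (-r * -(b + β + p' * k))) * t

lemma altSum_eq {q : K} (h0 : q ≠ 0) (hq : ∀ n : ℕ, 0 < n → q ^ n ≠ 1) (p : ℕ) {p' : ℕ}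
    (hp' : 0 < p') (r a b β : ℤ) (ha : a = b + 2 * β) (m : ℕ) :
    altSum q p p' r a b m =
      qPoch q q m * q ^ (r * β) * imageSum q (imageCoeff q p p' a) m r b := by
  have hI : imageSum q (imageCoeff q p p' a) m r b = imageSum q (translateCoeff q p p' a) m r b -
      imageSum q (fun x => translateCoeff q p p' a (-x)) m r b :=
    (hasFinsum_imageSum _ _ _ _ _).unique (((hasFinsum_imageSum q (translateCoeff q p p' a) m r b).sub
      (hasFinsum_imageSum q (fun x => translateCoeff q p p' a (-x)) m r b)).congr fun l => by
        unfold imageCoeff; ring)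
  unfold altSum
  rw [show (a - b) / 2 = β by omega, show (a + b) / 2 = b + β by omega,
    finsum_translate_eq h0 hq p hp' r a b β ha, finsum_reflect_eq h0 hq p hp' r a b β ha, hI,
    mul_sub]

end ImageCoeff

/-! ### Integer parts of `x / t` and the standard labelling -/

section Floors

variable {p p' : ℕ}

/-- The integer part of `x / t`. -/
def floorDiv (p p' : ℕ) (x : ℤ) : ℤ :=
  x * p / p'

lemma floor_div_tpar (x : ℤ) : ⌊(x : ℚ) / tpar p p'⌋ = floorDiv p p' x := by
  unfold tpar floorDiv
  rw [div_div_eq_mul_div, ← Rat.floor_intCast_div_natCast]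
  push_cast
  rfl

lemma tau_eq (s : ℤ) : tau p p' s = floorDiv p p' (s + 1) - floorDiv p p' (s - 1) := by
  unfold tau
  rw [← floor_div_tpar, ← floor_div_tpar]
  push_cast
  rfl

lemma floorDiv_le (hp' : 0 < p') (x : ℤ) : floorDiv p p' x * p' ≤ x * p :=
  Int.ediv_mul_le _ (by positivity)

lemma lt_floorDiv (hp' : 0 < p') (x : ℤ) : x * p < floorDiv p p' x * p' + p' := by
  have := Int.lt_ediv_add_one_mul_self (x * p) (by positivity : (0 : ℤ) < p')
  unfold floorDiv
  linarith

lemma floorDiv_unique (hp' : 0 < p') {x n : ℤ} (h1 : n * p' ≤ x * p) (h2 : x * p < n * p' + p') :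
    floorDiv p p' x = n :=
  Int.ediv_eq_iff_of_pos (by positivity) |>.mpr ⟨by linarith, by linarith⟩

lemma one_lt_tpar_iff (hp : 0 < p) : 1 < tpar p p' ↔ p < p' := by
  unfold tpar
  rw [one_lt_div (by positivity)]
  norm_cast

lemma tpar_lt_two_iff (hp : 0 < p) : tpar p p' < 2 ↔ p' < 2 * p := by
  unfold tpar
  rw [div_lt_iff₀ (by positivity)]
  norm_cast

lemma three_halves_lt_tpar_iff (hp : 0 < p) : 3 / 2 < tpar p p' ↔ 3 * p < 2 * p' := by
  unfold tpar
  rw [div_lt_div_iff₀ (by norm_num) (by positivity), mul_comm (p' : ℚ)]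
  norm_cast

lemma tpar_le_five_thirds_iff (hp : 0 < p) : tpar p p' ≤ 5 / 3 ↔ 3 * p' ≤ 5 * p := by
  unfold tpar
  rw [div_le_div_iff₀ (by positivity) (by norm_num), mul_comm (p' : ℚ)]
  norm_cast

lemma floorDiv_zero : floorDiv p p' 0 = 0 := by simp [floorDiv]

lemma floorDiv_one (h1 : p < p') : floorDiv p p' 1 = 0 := floorDiv_unique (by omega) (by omega) (by omega)

lemma floorDiv_two (h1 : p < p') (h2 : p' < 2 * p) : floorDiv p p' 2 = 1 := floorDiv_unique (by omega) (by omega) (by omega)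

lemma floorDiv_last (h1 : p < p') (h2 : p' < 2 * p) : floorDiv p p' p' = p :=
  floorDiv_unique (by omega) (by linarith) (by nlinarith)

lemma floorDiv_last_sub_one (h1 : p < p') (h2 : p' < 2 * p) : floorDiv p p' (p' - 1) = p - 1 :=
  floorDiv_unique (by omega) (by linarith) (by nlinarith)

lemma floorDiv_last_sub_two (h1 : p < p') (h2 : p' < 2 * p) : floorDiv p p' (p' - 2) = p - 2 :=
  floorDiv_unique (by omega) (by linarith) (by nlinarith)

lemma floorDiv_add_one (h1 : p < p') (h2 : p' < 2 * p) (x : ℤ) :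
    floorDiv p p' (x + 1) = floorDiv p p' x ∨ floorDiv p p' (x + 1) = floorDiv p p' x + 1 := by
  have hp' : 0 < p' := by omega
  have a1 := floorDiv_le (p := p) hp' x
  have a2 := lt_floorDiv (p := p) hp' x
  by_cases h : (x + 1) * p < floorDiv p p' x * p' + p'
  · exact Or.inl (floorDiv_unique hp' (by linarith) h)
  · refine Or.inr (floorDiv_unique hp' (by linarith) ?_)
    have : (p : ℤ) < p' := by exact_mod_cast h1
    linarith

lemma floorDiv_add_two (h1 : p < p') (h2 : p' < 2 * p) (x : ℤ) :
    floorDiv p p' (x + 2) = floorDiv p p' x + 1 ∨ floorDiv p p' (x + 2) = floorDiv p p' x + 2 := by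
  have hp' : 0 < p' := by omega
  have a1 := floorDiv_le (p := p) hp' x
  have a2 := lt_floorDiv (p := p) hp' x
  have b1 : (p : ℤ) < p' := by exact_mod_cast h1
  have b2 : (p' : ℤ) < 2 * p := by exact_mod_cast h2
  by_cases h : (x + 2) * p < (floorDiv p p' x + 1) * p' + p'
  · exact Or.inl (floorDiv_unique hp' (by linarith) h)
  · exact Or.inr (floorDiv_unique hp' (by linarith) (by linarith))

lemma tau_eq_one_or_two (h1 : p < p') (h2 : p' < 2 * p) (s : ℤ) : tau p p' s = 1 ∨ tau p p' s = 2 := by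
  have := floorDiv_add_two h1 h2 (s - 1)
  rw [show s - 1 + 2 = s + 1 by ring] at this
  rw [tau_eq]
  omega

/-- By coprimality `xp/p'` is not an integer strictly between `0` and `p'`, whence the `-1`. -/
lemma floorDiv_symm (hcop : Nat.Coprime p p') {x : ℤ} (hx : 1 ≤ x) (hx' : x ≤ p' - 1) :
    floorDiv p p' (p' - x) = p - 1 - floorDiv p p' x := by
  have hp' : 0 < p' := by omega
  have a1 := floorDiv_le (p := p) hp' x
  have a2 := lt_floorDiv (p := p) hp' x
  have a3 : floorDiv p p' x * p' ≠ x * p := by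
    intro h
    have hd : (p' : ℤ) ∣ x * p := ⟨floorDiv p p' x, by linarith⟩
    have := Int.le_of_dvd (by omega)
      (Int.dvd_of_dvd_mul_left_of_gcd_one hd (by simpa using hcop.symm))
    omega
  have a4 := lt_of_le_of_ne a1 a3
  exact floorDiv_unique hp' (by linarith) (by linarith)

lemma tau_symm (hcop : Nat.Coprime p p') {s : ℤ} (hs : 2 ≤ s) (hs' : s ≤ p' - 2) :
    tau p p' (p' - s) = tau p p' s := by
  rw [tau_eq, tau_eq, show (p' : ℤ) - s + 1 = p' - (s - 1) by ring,
    show (p' : ℤ) - s - 1 = p' - (s + 1) by ring,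
    floorDiv_symm hcop (by omega) (by omega), floorDiv_symm hcop (by omega) (by omega)]
  ring

lemma tau_one (h1 : p < p') (h2 : p' < 2 * p) : tau p p' 1 = 1 := by
  have e0 := floorDiv_zero (p := p) (p' := p')
  have e2 := floorDiv_two h1 h2
  rw [tau_eq]
  norm_num [e0, e2]

/-- The symmetry of `τ` fails at the ends, since `0` and `p'/t = p` are themselves integers: `τ(1) =
1`, but here the value is `2`. -/
lemma tau_last (h1 : p < p') (h2 : p' < 2 * p) : tau p p' (p' - 1) = 2 := by
  have e0 := floorDiv_last h1 h2
  have e2 := floorDiv_last_sub_two h1 h2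
  rw [tau_eq, sub_add_cancel, sub_sub, show (1 : ℤ) + 1 = 2 by norm_num, e0, e2]
  ring

lemma tau_two (h1 : p < p') (h2 : p' < 2 * p) (h3 : 3 * p < 2 * p') : tau p p' 2 = 1 := by
  have e1 := floorDiv_one h1
  have e3 : floorDiv p p' 3 = 1 := floorDiv_unique (by omega) (by omega) (by omega)
  rw [tau_eq]
  norm_num [e1, e3]

/-- The exceptional `1_B` at `2` must not be followed by `1_A` at `4`; the bound `t ≤ 5/3` prevents
this through `5/t ≥ 3`. -/
lemma tau_four (h2 : p' < 2 * p) (h3 : 3 * p < 2 * p') (h5 : 3 * p' ≤ 5 * p) : tau p p' 4 = 2 := by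
  have e3 : floorDiv p p' 3 = 1 := floorDiv_unique (by omega) (by omega) (by omega)
  have e5 : floorDiv p p' 5 = 3 := floorDiv_unique (by omega) (by omega) (by omega)
  rw [tau_eq]
  norm_num [e3, e5]

/-- At the midpoint `s/t = p/2` is a half-integer and `1/2 < 1/t < 1`. Hence no self-symmetric
vertex has to choose between `1_A` and `1_B`. -/
lemma tau_half (h1 : p < p') (h2 : p' < 2 * p) (hcop : Nat.Coprime p p') {s : ℤ} (hs : 2 * s = p') : tau p p' s = 2 := by
  have hodd : ¬ 2 ∣ p := fun hd => by
    have := Nat.eq_one_of_dvd_coprimes hcop hd (by omega)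
    omega
  obtain ⟨k, hk⟩ : ∃ k : ℤ, (p : ℤ) = 2 * k + 1 := ⟨p / 2, by omega⟩
  have e1 : floorDiv p p' (s + 1) = k + 1 := by
    refine floorDiv_unique (by omega) ?_ ?_ <;> rw [← hs, add_mul, hk] <;> nlinarith
  have e2 : floorDiv p p' (s - 1) = k - 1 := by
    refine floorDiv_unique (by omega) ?_ ?_ <;> rw [← hs, sub_mul, hk] <;> nlinarith
  rw [tau_eq, e1, e2]
  ring

/-- The alternating label records which of the unit steps `n-1 → n → n+1` raises `[x/t]`: the second
for `1_A`, the first for `1_B`, both for `2`. As `1/t > 1/2`, two successive unit steps never both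
leave it fixed, and this produces the alternation. -/
lemma alternating_spec (h1 : p < p') (h2 : p' < 2 * p) (n : ℕ) (hn : 1 ≤ n) :
    (alternating p p' n = .two ↔ tau p p' n = 2) ∧
    (alternating p p' n = .oneA ↔
      floorDiv p p' n = floorDiv p p' (n - 1) ∧
      floorDiv p p' (n + 1) = floorDiv p p' n + 1) ∧
    (alternating p p' n = .oneB ↔
      floorDiv p p' n = floorDiv p p' (n - 1) + 1 ∧
      floorDiv p p' (n + 1) = floorDiv p p' n) := by
  induction n, hn using Nat.le_induction with
  | base =>
    have e0 := floorDiv_zero (p := p) (p' := p')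
    have e1 := floorDiv_one h1
    have e2 := floorDiv_two h1 h2
    have ht := tau_one h1 h2
    have : alternating p p' 1 = .oneA := by
      simp [alternating, ht]
    rw [this]
    simp [e0, e1, e2, ht]
  | succ n hn ih =>
    have a1 := floorDiv_add_one h1 h2 (n - 1)
    have a2 := floorDiv_add_one h1 h2 n
    have a3 := floorDiv_add_one h1 h2 (n + 1)
    have a4 := floorDiv_add_two h1 h2 (n - 1)
    have a5 := floorDiv_add_two h1 h2 n
    have ht := tau_eq (p := p) (p' := p') n
    have ht' := tau_eq (p := p) (p' := p') ((n : ℤ) + 1)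
    rw [alternating]
    push_cast
    rw [show (n : ℤ) + 1 + 1 = n + 2 by ring, add_sub_cancel_right] at *
    rw [show (n : ℤ) - 1 + 1 = n by ring, show (n : ℤ) - 1 + 2 = n + 1 by ring] at *
    obtain ⟨i1, i2, i3⟩ := ih
    split_ifs with h
    · simp only [true_iff, false_iff]
      omega
    · rcases hl : alternating p p' n with _ | _ | _ <;>
        simp only [hl, reduceCtorEq, true_iff, false_iff] at i1 i2 i3 ⊢ <;> omega

lemma isLabelling_alternating (hcop : Nat.Coprime p p') (h1 : p < p') (h2 : p' < 2 * p)
    (h3 : 3 * p < 2 * p') : IsLabelling p p' fun s => alternating p p' s.toNat := by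
  have spec (s : ℤ) (hs : 1 ≤ s) :
      (alternating p p' s.toNat = .two ↔ tau p p' s = 2) ∧
      (alternating p p' s.toNat = .oneA ↔
        floorDiv p p' s = floorDiv p p' (s - 1) ∧
        floorDiv p p' (s + 1) = floorDiv p p' s + 1) ∧
      (alternating p p' s.toNat = .oneB ↔
        floorDiv p p' s = floorDiv p p' (s - 1) + 1 ∧
        floorDiv p p' (s + 1) = floorDiv p p' s) := by
    have h := alternating_spec h1 h2 s.toNat (by omega)
    rwa [Int.toNat_of_nonneg (by omega)] at h
  have e1 := floorDiv_one h1
  have e2 := floorDiv_two h1 h2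
  refine ⟨fun s hs _ => (spec s hs).1, ?_, fun _ => ?_, fun s hs hs' => ?_, fun s hs _ hB hA => ?_⟩
  · refine (spec 1 le_rfl).2.1.mpr ?_
    norm_num [e1, e2, floorDiv_zero (p := p) (p' := p')]
  · have e3 : floorDiv p p' 3 = 1 := floorDiv_unique (by omega) (by omega) (by omega)
    refine (spec 2 (by norm_num)).2.2.mpr ?_
    norm_num [e1, e2, e3]
  -- Reflection reverses the order of the two unit steps.
  · rw [(spec s (by omega)).2.1, (spec (p' - s) (by omega)).2.2,
      floorDiv_symm hcop (by omega) (by omega),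
      show (p' : ℤ) - s + 1 = p' - (s - 1) by ring,
      show (p' : ℤ) - s - 1 = p' - (s + 1) by ring,
      floorDiv_symm hcop (by omega) (by omega), floorDiv_symm hcop (by omega) (by omega)]
    omega
  -- The steps `s → s+1 → s+2` would both leave `[x/t]` fixed.
  · have hB' := (spec s hs).2.2.mp hB
    have hA' := (spec (s + 2) (by omega)).2.1.mp hA
    have := floorDiv_add_two h1 h2 s
    rw [show s + 2 - 1 = s + 1 by ring] at hA'
    omega

lemma isLabelling_half (hp : 3 ≤ p) (hcop : Nat.Coprime p p') (h1 : p < p') (h2 : p' < 2 * p)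
    (h5 : 3 * p' ≤ 5 * p) {ρ : ℤ → Label} (hρ : ∀ s, ρ s = if tau p p' s = 2 then .two
      else if 3 * p < 2 * p' ∧ s = 2 then .oneB
      else if 3 * p < 2 * p' ∧ s = p' - 2 then .oneA
      else if 2 * s < p' then .oneA else .oneB) : IsLabelling p p' ρ := by
  have t1 := tau_one h1 h2
  refine ⟨fun s hs _ => ?_, ?_, fun h => ?_, fun s hs hs' => ?_, fun s hs hs' => ?_⟩
  · rw [hρ]
    split_ifs <;> simp_all
  · rw [hρ, t1, if_neg (by norm_num), if_neg (by omega), if_neg (by omega), if_pos (by omega)]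
  · have h3 := (three_halves_lt_tpar_iff (by omega)).mp h
    rw [hρ, tau_two h1 h2 h3, if_neg (by norm_num), if_pos ⟨h3, rfl⟩]
  · have ht := tau_symm hcop hs hs'
    have hh : 2 * s = p' → tau p p' s = 2 := fun h => tau_half h1 h2 hcop h
    rw [hρ, hρ, ht]
    split_ifs <;> simp only [true_iff, iff_true, iff_self] <;> omega
  · intro hB hA
    -- Apart from the exceptional labels, every `1_A` lies to the left of every `1_B`. So only the
    -- pairs `2, 4` and `p'-4, p'-2` need care.
    have h4 : 3 * p < 2 * p' → tau p p' 4 = 2 := fun h => tau_four h2 h h5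
    have h4' : 3 * p < 2 * p' → s = p' - 4 → 2 ≤ s → tau p p' s = 2 := fun h hs4 h2s => by
      rw [← tau_symm hcop h2s (by omega), hs4, sub_sub_cancel]
      exact h4 h
    rw [hρ] at hA hB
    have h24 : 3 * p < 2 * p' → s = 2 → tau p p' (s + 2) = 2 := by
      rintro h rfl
      exact h4 h
    have hs1 : s = 1 → tau p p' s = 1 := by rintro rfl; exact t1
    split_ifs at hA hB <;> omega

theorem isLabelling_standardLabel (hp : 3 ≤ p) (hcop : Nat.Coprime p p') (h1 : p < p')
    (h2 : p' < 2 * p) : IsLabelling p p' (standardLabel p p') := by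
  by_cases h5 : tpar p p' ≤ 5 / 3
  · refine isLabelling_half hp hcop h1 h2 ((tpar_le_five_thirds_iff (by omega)).mp h5) fun s => ?_
    unfold standardLabel
    simp only [if_pos h5, three_halves_lt_tpar_iff (by omega : 0 < p)]
  · have h5' := mt (tpar_le_five_thirds_iff (p' := p') (by omega : 0 < p)).mpr h5
    have h := isLabelling_alternating hcop h1 h2 (by omega)
    have key (s : ℤ) (hs : 1 ≤ s) (hs' : s ≤ p' - 1) :
        standardLabel p p' s = alternating p p' s.toNat := by
      unfold standardLabel
      rw [if_neg h5]
      split_ifs with ht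
      · exact ((h.two_iff s hs hs').mpr ht).symm
      · rfl
    refine ⟨fun s hs hs' => ?_, ?_, fun ht => ?_, fun s hs hs' => ?_, fun s hs hs' => ?_⟩
    · rw [key s hs hs']
      exact h.two_iff s hs hs'
    · rw [key 1 le_rfl (by omega)]
      exact h.at_one
    · rw [key 2 (by norm_num) (by omega)]
      exact h.at_two ht
    · rw [key s (by omega) (by omega), key (p' - s) (by omega) (by omega)]
      exact h.symm s hs hs'
    · rw [key s hs (by omega), key (s + 2) (by omega) hs']
      exact h.no_BA s hs hs'

end Floors

/-! ### Integer weights and the energy of a path -/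

section Paths

variable {p p' : ℕ}

/-- The difference `y - 2 τ` for the three cases. -/
def Label.shift : Label → ℤ
  | .oneA => 1
  | .oneB => 0
  | .two => 0

/-- The integer part of the weight, up to a second difference of `s² / (4 t)`. -/
def intWeight (p p' : ℕ) (ρ : ℤ → Label) (d b c : ℤ) : ℤ :=
  if c = b + 2 then
    if d = b + 2 then -2 * floorDiv p p' (b + 1) + (ρ (b + 2)).shift
    else if d = b then 1 - floorDiv p p' (b + 1) else 0
  else if c = b then
    if d = b + 2 then 1 - floorDiv p p' (b + 1)
    else if d = b then 3 - tau p p' b else 2 + floorDiv p p' (b - 1)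
  else
    if d = b + 2 then 0
    else if d = b then 2 + floorDiv p p' (b - 1)
    else 2 * floorDiv p p' (b - 1) + (ρ (b - 2)).x

/-- `s² / (4 t)` -/
def quadWeight (p p' : ℕ) (s : ℤ) : ℚ :=
  (s : ℚ) ^ 2 / (4 * tpar p p')

lemma fract_div_tpar (x : ℤ) :
    Int.fract ((x : ℚ) / tpar p p') = x / tpar p p' - floorDiv p p' x := by
  rw [Int.fract, floor_div_tpar]

/-- Splitting `{x/t}` as `x/t - [x/t]`, the part over `t` is the second difference; a straight step,
for instance, has `2/t` and integer part zero. The labelling hypothesis enters only for `d = c =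
b+2`, where `y = 2τ + shift` trades `[(b+3)/t]` for `[(b+1)/t]`. -/
lemma weight_eq (h1 : p < p') (h2 : p' < 2 * p) {ρ : ℤ → Label} (hρ : IsLabelling p p' ρ)
    {d b c : ℤ} (hd : d = b ∨ d = b + 2 ∨ d = b - 2) (hc : c = b ∨ c = b + 2 ∨ c = b - 2)
    (hc1 : 1 ≤ c) (hc2 : c ≤ p' - 1) :
    weight p p' ρ d b c = intWeight p p' ρ d b c +
      (quadWeight p p' d + quadWeight p p' c - 2 * quadWeight p p' b) := by
  have ht : tpar p p' ≠ 0 := by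
    unfold tpar
    have : 0 < p := by omega
    have : 0 < p' := by omega
    positivity
  have f0 := fract_div_tpar (p := p) (p' := p') (b + 1)
  have f1 := fract_div_tpar (p := p) (p' := p') (b - 1)
  have f2 := fract_div_tpar (p := p) (p' := p') (b + 3)
  push_cast at f0 f1 f2
  have g1 : ((b : ℚ) - 2 + 1) = b - 1 := by ring
  have g2 : ((b : ℚ) + 2 + 1) = b + 3 := by ring
  unfold quadWeight weight intWeight
  rcases hd with rfl | rfl | rfl <;> rcases hc with rfl | rfl | rfl
  · rw [if_neg (by omega), if_neg (by omega), if_neg (by omega), if_neg (by omega),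
      if_neg (by omega), if_neg (by omega), if_pos (by omega), if_neg (by omega), if_pos rfl,
      if_neg (by omega), if_pos rfl]
    push_cast
    ring
  · rw [if_neg (by omega), if_neg (by omega), if_neg (by omega), if_pos (by omega), if_pos rfl,
      if_neg (by omega), if_pos rfl, f0]
    push_cast
    field_simp
    ring
  · rw [if_neg (by omega), if_neg (by omega), if_pos (by omega), if_neg (by omega),
      if_neg (by omega), if_neg (by omega), if_pos rfl]
    push_cast
    rw [g1, f1]
    field_simp
    ring
  · rw [if_neg (by omega), if_neg (by omega), if_neg (by omega), if_neg (by omega),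
      if_pos (by omega), if_neg (by omega), if_pos rfl, if_pos rfl, f0]
    push_cast
    field_simp
    ring
  · rw [if_neg (by omega), if_neg (by omega), if_neg (by omega), if_neg (by omega),
      if_neg (by omega), if_neg (by omega), if_neg (by omega), if_pos (by omega), if_pos rfl,
      if_pos rfl]
    have hy : (ρ (b + 2)).y = 2 * (floorDiv p p' (b + 3) - floorDiv p p' (b + 1)) +
        (ρ (b + 2)).shift := by
      have e := tau_eq (p := p) (p' := p') (b + 2)
      rw [show b + 2 + 1 = b + 3 by ring, show b + 2 - 1 = b + 1 by ring] at e
      have h := hρ.two_iff (b + 2) hc1 hc2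
      have h12 := tau_eq_one_or_two h1 h2 (b + 2)
      rw [← e]
      cases hl : ρ (b + 2) <;> simp only [hl, reduceCtorEq, true_iff, false_iff] at h <;>
        simp only [Label.y, Label.shift] <;> omega
    rw [hy]
    push_cast
    rw [g2, f2]
    field_simp
    ring
  · rw [if_pos (by omega), if_neg (by omega), if_neg (by omega), if_pos rfl]
    push_cast
    field_simp
    ring
  · rw [if_neg (by omega), if_pos (by omega), if_neg (by omega), if_pos rfl, if_neg (by omega),
      if_neg (by omega)]
    push_cast
    rw [g1, f1]
    field_simp
    ring
  · rw [if_pos (by omega), if_pos rfl, if_neg (by omega), if_neg (by omega)]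
    push_cast
    field_simp
    ring
  · rw [if_neg (by omega), if_neg (by omega), if_neg (by omega), if_neg (by omega),
      if_neg (by omega), if_pos (by omega), if_neg (by omega), if_neg (by omega),
      if_neg (by omega), if_neg (by omega)]
    push_cast
    rw [g1, f1]
    field_simp
    ring

/-- The steps that are allowed on paths. -/
def IsStep (p' : ℕ) (d b : ℤ) : Prop :=
  (d = b ∨ d = b + 2 ∨ d = b - 2) ∧ ¬ (d = 1 ∧ b = 1) ∧ ¬ (d = p' - 1 ∧ b = p' - 1)

lemma mem_paths {a b : ℤ} {m : ℕ} {s : Fin (m + 1) → ℤ} :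
    s ∈ paths p' a b m ↔ (∀ i, 1 ≤ s i ∧ s i ≤ p' - 1) ∧ s 0 = a ∧ s (Fin.last m) = b ∧
      ∀ i : Fin m, IsStep p' (s i.castSucc) (s i.succ) := by
  simp only [paths, Finset.mem_filter, Fintype.mem_piFinset, Finset.mem_Icc, IsStep]

lemma snoc_mem_paths {a b : ℤ} {m : ℕ} {s : Fin (m + 1) → ℤ} :
    (Fin.snoc s b : Fin (m + 2) → ℤ) ∈ paths p' a b (m + 1) ↔
      s ∈ paths p' a (s (Fin.last m)) m ∧ (1 ≤ b ∧ b ≤ p' - 1) ∧ IsStep p' (s (Fin.last m)) b := by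
  simp only [mem_paths]
  rw [Fin.forall_fin_succ', Fin.forall_fin_succ' (P := fun i : Fin (m + 1) => IsStep p'
    ((Fin.snoc s b : Fin (m + 2) → ℤ) i.castSucc) ((Fin.snoc s b : Fin (m + 2) → ℤ) i.succ))]
  simp only [Fin.snoc_castSucc, Fin.snoc_last, Fin.succ_castSucc, Fin.succ_last,
    ← Fin.castSucc_zero]
  tauto

open Classical in
lemma sum_paths_succ {M : Type*} [AddCommMonoid M] (a : ℤ) {b : ℤ} (hb : 1 ≤ b)
    (hb' : b ≤ p' - 1) (m : ℕ) (φ : (Fin (m + 2) → ℤ) → M) :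
    ∑ s ∈ paths p' a b (m + 1), φ s = ∑ d ∈ Finset.Icc (1 : ℤ) (p' - 1),
      if IsStep p' d b then ∑ s ∈ paths p' a d m, φ (Fin.snoc s b) else 0 := by
  have hsnoc (s : Fin (m + 2) → ℤ) (hs : s ∈ paths p' a b (m + 1)) :
      (Fin.snoc (Fin.init s) b : Fin (m + 2) → ℤ) = s := by
    rw [← (mem_paths.mp hs).2.2.1]
    exact Fin.snoc_init_self s
  have hinit (s : Fin (m + 2) → ℤ) (hs : s ∈ paths p' a b (m + 1)) :=
    snoc_mem_paths.mp ((hsnoc s hs).symm ▸ hs)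
  rw [← Finset.sum_fiberwise_of_maps_to (t := Finset.Icc (1 : ℤ) (p' - 1))
    (g := fun s => Fin.init s (Fin.last m))
    (fun s hs => Finset.mem_Icc.mpr ((mem_paths.mp hs).1 _))]
  refine Finset.sum_congr rfl fun d _ => ?_
  split_ifs with hd
  · refine Finset.sum_bij' (fun s _ => Fin.init s) (fun s _ => Fin.snoc s b) ?_ ?_ ?_ ?_ ?_
    · intro s hs
      obtain ⟨hs', rfl⟩ := Finset.mem_filter.mp hs
      exact (hinit s hs').1
    · intro s hs
      have hl := (mem_paths.mp hs).2.2.1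
      subst hl
      simp only [Finset.mem_filter, Fin.init_snoc, and_true]
      exact snoc_mem_paths.mpr ⟨hs, ⟨hb, hb'⟩, hd⟩
    · intro s hs
      exact hsnoc s (Finset.mem_filter.mp hs).1
    · intro s _
      exact Fin.init_snoc _ _
    · intro s hs
      rw [hsnoc s (Finset.mem_filter.mp hs).1]
  · refine Finset.sum_eq_zero fun s hs => ?_
    obtain ⟨hs', rfl⟩ := Finset.mem_filter.mp hs
    exact absurd (hinit s hs').2.2 hd

/-- The vertices of a path, extended by zero. -/
def vertex {m : ℕ} (s : Fin (m + 1) → ℤ) (i : ℕ) : ℤ :=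
  if h : i < m + 1 then s ⟨i, h⟩ else 0

lemma vertex_of_lt {m : ℕ} (s : Fin (m + 1) → ℤ) {i : ℕ} (h : i < m + 1) :
    vertex s i = s ⟨i, h⟩ :=
  dif_pos h

lemma vertex_snoc_of_lt {m : ℕ} (s : Fin (m + 1) → ℤ) (c : ℤ) {i : ℕ} (h : i < m + 1) :
    vertex (Fin.snoc s c : Fin (m + 2) → ℤ) i = vertex s i := by
  rw [vertex_of_lt s h, vertex_of_lt _ (by omega : i < m + 1 + 1)]
  exact Fin.snoc_castSucc (α := fun _ => ℤ) c s ⟨i, h⟩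

lemma vertex_snoc_last {m : ℕ} (s : Fin (m + 1) → ℤ) (c : ℤ) :
    vertex (Fin.snoc s c : Fin (m + 2) → ℤ) (m + 1) = c := by
  rw [vertex_of_lt _ (by omega : m + 1 < m + 1 + 1)]
  exact Fin.snoc_last (α := fun _ => ℤ) c s

/-- The energy with respect to the integer weights. -/
def intEnergy (p p' : ℕ) (ρ : ℤ → Label) {m : ℕ} (s : Fin (m + 1) → ℤ) : ℤ :=
  ∑ i ∈ Finset.range (m - 1),
    ((i : ℤ) + 1) * intWeight p p' ρ (vertex s i) (vertex s (i + 1)) (vertex s (i + 2))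

lemma intEnergy_snoc (ρ : ℤ → Label) {m : ℕ} (s : Fin (m + 2) → ℤ) (c : ℤ) :
    intEnergy p p' ρ (Fin.snoc s c : Fin (m + 3) → ℤ) = intEnergy p p' ρ s +
      ((m : ℤ) + 1) * intWeight p p' ρ (vertex s m) (vertex s (m + 1)) c := by
  unfold intEnergy
  rw [show m + 2 - 1 = m + 1 - 1 + 1 by omega, Finset.sum_range_succ]
  congr 1
  · refine Finset.sum_congr rfl fun i hi => ?_
    have := Finset.mem_range.mp hi
    rw [vertex_snoc_of_lt _ _ (by omega), vertex_snoc_of_lt _ _ (by omega),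
      vertex_snoc_of_lt _ _ (by omega)]
  · rw [Nat.add_sub_cancel, vertex_snoc_of_lt _ _ (by omega), vertex_snoc_of_lt _ _ (by omega),
      vertex_snoc_last]

/-- Two summations by parts: only the last two vertices and the first one survive. -/
lemma sum_second_difference (h : ℕ → ℚ) (m : ℕ) :
    ∑ i ∈ Finset.range m, ((i : ℚ) + 1) * (h i + h (i + 2) - 2 * h (i + 1)) =
      m * h (m + 1) - (m + 1) * h m + h 0 := by
  induction m with
  | zero => simp
  | succ k ih =>
    rw [Finset.sum_range_succ, ih]
    push_cast
    ring

lemma energy_eq (h1 : p < p') (h2 : p' < 2 * p) {ρ : ℤ → Label} (hρ : IsLabelling p p' ρ)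
    {a b : ℤ} {m : ℕ} {s : Fin (m + 2) → ℤ} (hs : s ∈ paths p' a b (m + 1)) :
    energy p p' ρ s = intEnergy p p' ρ s + (m * quadWeight p p' b -
      (m + 1) * quadWeight p p' (vertex s m) + quadWeight p p' a) := by
  obtain ⟨hr, h0, hl, hst⟩ := mem_paths.mp hs
  have e0 : vertex s 0 = a := by rw [vertex_of_lt s (by omega), ← h0]; rfl
  have el : vertex s (m + 1) = b := by rw [vertex_of_lt s (by omega), ← hl]; rfl
  have hstep (i : ℕ) (hi : i < m + 1) : IsStep p' (vertex s i) (vertex s (i + 1)) := by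
    rw [vertex_of_lt s (by omega), vertex_of_lt s (by omega)]
    exact hst ⟨i, hi⟩
  have hsum := sum_second_difference (fun i => quadWeight p p' (vertex s i)) m
  simp only [e0, el] at hsum
  rw [← hsum]
  unfold energy intEnergy
  push_cast
  rw [← Finset.sum_add_distrib]
  refine Eq.trans ?_ (Fin.sum_univ_eq_sum_range (fun i : ℕ =>
    ((i : ℚ) + 1) * (intWeight p p' ρ (vertex s i) (vertex s (i + 1)) (vertex s (i + 2)) : ℚ) +
    ((i : ℚ) + 1) * (quadWeight p p' (vertex s i) + quadWeight p p' (vertex s (i + 2)) -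
      2 * quadWeight p p' (vertex s (i + 1)))) m)
  refine Finset.sum_congr rfl fun i _ => ?_
  have hi := i.2
  have s1 := hstep i (by omega)
  have s2 := hstep (i + 1) (by omega)
  have hr2 := hr ⟨i + 2, by omega⟩
  rw [← vertex_of_lt s (by omega)] at hr2
  rw [← mul_add, ← weight_eq h1 h2 hρ s1.1 (by have := s2.1; rw [show (i : ℕ) + 1 + 1 = i + 2 from rfl] at this; omega) hr2.1 hr2.2]
  rw [vertex_of_lt s (by omega), vertex_of_lt s (by omega), vertex_of_lt s (by omega)]

end Paths

/-! ### Path sums and the formulas they satisfy -/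

section PathSum

variable {K : Type*} [Field K] {q : K} {p p' : ℕ} {ρ : ℤ → Label} {a : ℤ}

/-- The generating function of the integer energies of the paths from `a` to `b` of length `m`
that are continued by a vertex `c`. -/
def pathSum (q : K) (p p' : ℕ) (ρ : ℤ → Label) (a : ℤ) (m : ℕ) (b c : ℤ) : K :=
  ∑ s ∈ paths p' a b m, q ^ intEnergy p p' ρ (Fin.snoc s c : Fin (m + 2) → ℤ)

lemma paths_eq_empty {m : ℕ} {b : ℤ} (hb : b < 1 ∨ p' - 1 < b) : paths p' a b m = ∅ := by
  refine Finset.eq_empty_of_forall_notMem fun s hs => ?_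
  obtain ⟨hr, -, hl, -⟩ := mem_paths.mp hs
  have := hr (Fin.last m)
  omega

lemma pathSum_eq_zero (q : K) (p : ℕ) (ρ : ℤ → Label) (a : ℤ) (m : ℕ) {b : ℤ} (c : ℤ)
    (hb : b < 1 ∨ p' - 1 < b) : pathSum q p p' ρ a m b c = 0 := by
  rw [pathSum, paths_eq_empty hb, Finset.sum_empty]

lemma paths_zero (ha : 1 ≤ a) (ha' : a ≤ p' - 1) (b : ℤ) :
    paths p' a b 0 = if a = b then {fun _ => a} else ∅ := by
  ext s
  rw [mem_paths]
  split_ifs with h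
  · subst h
    rw [Finset.mem_singleton]
    constructor
    · rintro ⟨-, h0, -⟩
      funext i
      rw [show i = 0 from Fin.eq_zero i, h0]
    · rintro rfl
      exact ⟨fun _ => ⟨ha, ha'⟩, rfl, rfl, fun i => i.elim0⟩
  · simp only [Finset.notMem_empty, iff_false]
    rintro ⟨-, h0, hl, -⟩
    exact h (h0.symm.trans hl)

lemma pathSum_zero (q : K) (p : ℕ) (ρ : ℤ → Label) (ha : 1 ≤ a) (ha' : a ≤ p' - 1) (b c : ℤ) :
    pathSum q p p' ρ a 0 b c = if a = b then 1 else 0 := by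
  rw [pathSum, paths_zero ha ha']
  split_ifs <;> simp [intEnergy]

open Classical in
lemma sum_isStep {b : ℤ} {g : ℤ → K} (hg : ∀ d : ℤ, d < 1 ∨ p' - 1 < d → g d = 0) :
    (∑ d ∈ Finset.Icc (1 : ℤ) (p' - 1), if IsStep p' d b then g d else 0) =
      g (b + 2) + (if b = 1 ∨ b = p' - 1 then 0 else g b) + g (b - 2) := by
  set f : ℤ → K := fun d => if IsStep p' d b then g d else 0 with hf
  have h1 : f.support ⊆ ↑(Finset.Icc (1 : ℤ) (p' - 1)) := fun d hd => by
    rw [Finset.coe_Icc, Set.mem_Icc]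
    by_contra hn
    apply hd
    simp only [hf, hg d (by omega), ite_self]
  have h2 : f.support ⊆ ↑({b + 2, b, b - 2} : Finset ℤ) := fun d hd => by
    by_contra hn
    apply hd
    simp only [hf]
    rw [if_neg]
    intro hs
    apply hn
    have := hs.1
    simp only [Finset.coe_insert, Finset.coe_singleton, Set.mem_insert_iff, Set.mem_singleton_iff]
    omega
  -- Neighbours beyond the walls contribute zero and may be included; only the forbidden horizontal
  -- steps need a case distinction.
  rw [← finsum_eq_sum_of_support_subset f h1, finsum_eq_sum_of_support_subset f h2,
    Finset.sum_insert (by simp; omega), Finset.sum_insert (by simp; omega), Finset.sum_singleton, ← add_assoc]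
  simp only [hf]
  have s1 : IsStep p' (b + 2) b := ⟨by omega, by omega, by omega⟩
  have s2 : IsStep p' (b - 2) b := ⟨by omega, by omega, by omega⟩
  rw [if_pos s1, if_pos s2]
  congr 2
  by_cases h : b = 1 ∨ b = p' - 1
  · rw [if_pos h, if_neg]
    rintro ⟨-, h3, h4⟩
    omega
  · rw [if_neg h, if_pos ⟨by omega, by omega, by omega⟩]

/-- The energy added by a further vertex and the boundary term of the exponent both see the path,
once its end is fixed, only through the vertex before the end. This sum serves both. -/
lemma sum_paths_zpow (h0 : q ≠ 0) (p : ℕ) (ρ : ℤ → Label) (a : ℤ) {b : ℤ} (hb : 1 ≤ b)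
    (hb' : b ≤ p' - 1) (m : ℕ) (w : ℤ → ℤ) :
    ∑ s ∈ paths p' a b (m + 1), q ^ (intEnergy p p' ρ s + w (vertex s m)) =
      q ^ w (b + 2) * pathSum q p p' ρ a m (b + 2) b +
      (if b = 1 ∨ b = p' - 1 then 0 else q ^ w b * pathSum q p p' ρ a m b b) +
      q ^ w (b - 2) * pathSum q p p' ρ a m (b - 2) b := by
  classical
  rw [sum_paths_succ a hb hb', ← sum_isStep (p' := p') (b := b)
    (g := fun d => q ^ w d * pathSum q p p' ρ a m d b)
    (fun d hd => by rw [pathSum_eq_zero q p ρ a m b hd, mul_zero])]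
  refine Finset.sum_congr rfl fun d _ => if_congr Iff.rfl ?_ rfl
  rw [pathSum, Finset.mul_sum]
  refine Finset.sum_congr rfl fun s hs => ?_
  rw [vertex_snoc_of_lt _ _ (by omega), vertex_of_lt s (by omega), ← (mem_paths.mp hs).2.2.1,
    zpow_add₀ h0, mul_comm]
  rfl

lemma pathSum_succ (h0 : q ≠ 0) (p : ℕ) (ρ : ℤ → Label) (a : ℤ) {b : ℤ} (hb : 1 ≤ b)
    (hb' : b ≤ p' - 1) (m : ℕ) (c : ℤ) :
    pathSum q p p' ρ a (m + 1) b c =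
      q ^ (((m : ℤ) + 1) * intWeight p p' ρ (b + 2) b c) * pathSum q p p' ρ a m (b + 2) b +
      (if b = 1 ∨ b = p' - 1 then 0
        else q ^ (((m : ℤ) + 1) * intWeight p p' ρ b b c) * pathSum q p p' ρ a m b b) +
      q ^ (((m : ℤ) + 1) * intWeight p p' ρ (b - 2) b c) * pathSum q p p' ρ a m (b - 2) b := by
  rw [← sum_paths_zpow h0 p ρ a hb hb' m fun d => ((m : ℤ) + 1) * intWeight p p' ρ d b c]
  refine Finset.sum_congr rfl fun s hs => ?_
  rw [intEnergy_snoc, vertex_of_lt s (by omega : m + 1 < m + 1 + 1), ← (mem_paths.mp hs).2.2.1]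
  rfl

/-- The expressions for the path sums in terms of the image sums. -/
structure PathFormulas (q : K) (p p' : ℕ) (ρ : ℤ → Label) (a : ℤ) (C : ℤ → K) (m : ℕ) :
    Prop where
  up : ∀ b : ℤ, 0 ≤ b → b ≤ p' - 3 → ρ (b + 2) ≠ .oneA →
    pathSum q p p' ρ a m b (b + 2) = qPoch q q m * (q ^ (-(m : ℤ) * floorDiv p p' (b + 1)) *
      imageSum q C m (floorDiv p p' (b + 1)) b)
  up_oneA : ∀ b : ℤ, 0 ≤ b → b ≤ p' - 3 → ρ (b + 2) = .oneA →
    pathSum q p p' ρ a m b (b + 2) = qPoch q q m * (q ^ (-(m : ℤ) * floorDiv p p' (b + 1)) *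
      (imageSum q C m (floorDiv p p' (b + 1)) b - q ^ ((m : ℤ) - 1 - floorDiv p p' (b + 1)) *
        imageSum q C (m - 1) (floorDiv p p' (b + 1) + 1) (b + 2)))
  down : ∀ b : ℤ, 3 ≤ b → b ≤ p' → ρ (b - 2) ≠ .oneB →
    pathSum q p p' ρ a m b (b - 2) = qPoch q q m * (q ^ ((m : ℤ) * (floorDiv p p' (b - 1) + 1)) *
      imageSum q C m (floorDiv p p' (b - 1) + 1) b)
  down_oneB : ∀ b : ℤ, 3 ≤ b → b ≤ p' → ρ (b - 2) = .oneB →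
    pathSum q p p' ρ a m b (b - 2) = qPoch q q m * (q ^ ((m : ℤ) * (floorDiv p p' (b - 1) + 1)) *
      (imageSum q C m (floorDiv p p' (b - 1) + 1) b - q ^ ((m : ℤ) + floorDiv p p' (b - 1)) *
        imageSum q C (m - 1) (floorDiv p p' (b - 1)) (b - 2)))
  flat_one : ∀ b : ℤ, 2 ≤ b → b ≤ p' - 2 → tau p p' b = 1 →
    pathSum q p p' ρ a m b b =
      qPoch q q m * (q ^ (m : ℤ) * imageSum q C m (floorDiv p p' (b + 1)) b)
  flat_two : ∀ b : ℤ, 2 ≤ b → b ≤ p' - 2 → tau p p' b = 2 →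
    pathSum q p p' ρ a m b b = qPoch q q m * (imageSum q C m (floorDiv p p' (b + 1)) b -
      q ^ ((m : ℤ) - 1 - floorDiv p p' (b + 1)) *
        imageSum q C (m - 1) (floorDiv p p' (b + 1) + 1) (b + 2))
  -- Where `τ(b) = 2` two rows are available; this is the same path sum expressed in the lower one.
  flat_two' : ∀ b : ℤ, 2 ≤ b → b ≤ p' - 2 → tau p p' b = 2 →
    pathSum q p p' ρ a m b b = qPoch q q m * (imageSum q C m (floorDiv p p' (b - 1) + 1) b -
      q ^ ((m : ℤ) + floorDiv p p' (b - 1)) *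
        imageSum q C (m - 1) (floorDiv p p' (b - 1)) (b - 2))

/-- The last step of the path sums: the paths to `b`, weighted as in the character formula for
the row `r`. -/
def FinalFormula (q : K) (p p' : ℕ) (ρ : ℤ → Label) (a : ℤ) (C : ℤ → K) (m : ℕ) : Prop :=
  ∀ b r : ℤ, 1 ≤ b → b ≤ p' - 1 →
    (r = floorDiv p p' (b + 1) ∧ b ≤ p' - 2) ∨ r = floorDiv p p' (b - 1) + 1 →
    q ^ (-((m : ℤ) + 1) * r) * pathSum q p p' ρ a m (b + 2) b +
      (if b = 1 ∨ b = p' - 1 then 0 else q ^ ((m : ℤ) + 1) * pathSum q p p' ρ a m b b) +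
      q ^ (((m : ℤ) + 1) * r) * pathSum q p p' ρ a m (b - 2) b =
    qPoch q q (m + 1) * imageSum q C (m + 1) r b

lemma IsLabelling.tau_of_ne_two (hρ : IsLabelling p p' ρ) (h1 : p < p') (h2 : p' < 2 * p) {s : ℤ}
    (hs : 1 ≤ s) (hs' : s ≤ p' - 1) (h : ρ s ≠ .two) : tau p p' s = 1 :=
  (tau_eq_one_or_two h1 h2 s).resolve_right fun h' => h ((hρ.two_iff s hs hs').mpr h')

/-- If `t < 3/2` then `τ(2) = 2`, and `t = 3/2` would force `p = 2`. This excludes a correction for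
the step from the wall `0` to `2`. -/
lemma IsLabelling.two_ne_oneA (hρ : IsLabelling p p' ρ) (hcop : Nat.Coprime p p')
    (hp : 3 ≤ p) (h1 : p < p') (h2 : p' < 2 * p) : ρ 2 ≠ .oneA := by
  intro hA
  by_cases h3 : 3 * p < 2 * p'
  · rw [hρ.at_two ((three_halves_lt_tpar_iff (by omega)).mpr h3)] at hA
    cases hA
  · have h4 : 3 * p ≠ 2 * p' := fun h => by
      have := Nat.Coprime.dvd_of_dvd_mul_right hcop (⟨3, by omega⟩ : p ∣ 2 * p')
      have := Nat.le_of_dvd (by norm_num) this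
      omega
    have e3 : floorDiv p p' 3 = 2 := floorDiv_unique (by omega) (by omega) (by omega)
    have ht : tau p p' 2 = 2 := by
      rw [tau_eq]
      norm_num [e3, floorDiv_one h1]
    rw [(hρ.two_iff 2 (by norm_num) (by omega)).mpr ht] at hA
    cases hA

lemma IsLabelling.last_ne_oneB (hρ : IsLabelling p p' ρ) (hcop : Nat.Coprime p p')
    (hp : 3 ≤ p) (h1 : p < p') (h2 : p' < 2 * p) : ρ (p' - 2) ≠ .oneB := fun h =>
  hρ.two_ne_oneA hcop hp h1 h2 ((hρ.symm 2 le_rfl (by omega)).mpr h)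

end PathSum

/-! ### The induction on the length -/

section Induction

variable {K : Type*} [Field K] {q : K} {p p' : ℕ} {ρ : ℤ → Label} {a : ℤ} {C : ℤ → K}

/-- At length zero the image sum is `C(b)` and the corrections, of length `-1`, vanish. The formulas
include the walls `0` and `p'`, where `C` is zero by antisymmetry. -/
lemma pathFormulas_zero [CharZero K] (h0 : q ≠ 0) (hC : IsAntisymmetric q p p' C) (ha : 1 ≤ a) (ha' : a ≤ p' - 1)
    (hCa : ∀ b : ℤ, 1 ≤ b → b ≤ p' - 1 → C b = if a = b then 1 else 0) :
    PathFormulas q p p' ρ a C 0 := by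
  have hneg (r b : ℤ) : imageSum q C (-1) r b = 0 := imageSum_of_neg q C (by norm_num) r b
  have hC0 : C 0 = 0 := by
    rw [← imageSum_zero q C 0 0, hC.imageSum_zero_zero h0]
  have hCl : C p' = 0 := by
    rw [← imageSum_zero q C p p', hC.imageSum_wall h0]
  have hb (b : ℤ) (hb : 0 ≤ b) (hb' : b ≤ p') : C b = if a = b then 1 else 0 := by
    by_cases h : b = 0
    · rw [h, hC0, if_neg (by omega)]
    by_cases h' : b = p'
    · rw [h', hCl, if_neg (by omega)]
    exact hCa b (by omega) (by omega)
  constructor <;> intros <;>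
    simp [pathSum_zero q p ρ ha ha', imageSum_zero, hneg, qPoch] <;>
    rw [hb _ (by omega) (by omega)]

/-- Away from the walls each label selects a recurrence of the image sum; at `1` and `p'-1` the
one-term relations take over. -/
lemma finalFormula_of_pathFormulas [CharZero K] (h0 : q ≠ 0)
    (hq : ∀ n : ℕ, 0 < n → q ^ n ≠ 1) (hp : 3 ≤ p) (h1 : p < p')
    (h2 : p' < 2 * p) (hC : IsAntisymmetric q p p' C) (hρ : IsLabelling p p' ρ) {m : ℕ}
    (F : PathFormulas q p p' ρ a C m) : FinalFormula q p p' ρ a C m := by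
  intro b r hb hb' hr
  have hQ := qPoch_self_succ q m
  by_cases hb1 : b = 1
  · subst hb1
    have e0 := floorDiv_zero (p := p) (p' := p')
    have e2 := floorDiv_two h1 h2
    obtain rfl : r = 1 := by
      norm_num [e0, e2] at hr
      omega
    have d := F.down 3 le_rfl (by omega) (by simp [hρ.at_one])
    norm_num [e2] at d
    have z := pathSum_eq_zero q p ρ a m (1 : ℤ) (Or.inl (by norm_num) : (1 - 2 : ℤ) < 1 ∨ (p' : ℤ) - 1 < 1 - 2)
    have i := hC.imageSum_one h0 hq m
    have e : q ^ (-((m : ℤ) + 1) * 1) * q ^ ((m : ℤ) * 2) = q ^ ((m : ℤ) - 1) :=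
      zpow_mul_zpow h0 (by ring)
    rw [if_pos (Or.inl rfl), z, hQ, show (1 : ℤ) + 2 = 3 by norm_num, d]
    linear_combination qPoch q q m * imageSum q C m 2 3 * e - qPoch q q m * i
  by_cases hbl : b = p' - 1
  · subst hbl
    have e2 := floorDiv_last_sub_two h1 h2
    have e2' : (p' : ℤ) - 1 - 1 = p' - 2 := by ring
    obtain rfl : r = p - 1 := by
      rw [e2', e2] at hr
      omega
    have hl : ρ (p' - 3 + 2) = .two := by
      rw [show (p' : ℤ) - 3 + 2 = p' - 1 by ring]
      exact (hρ.two_iff _ (by omega) le_rfl).mpr (tau_last h1 h2)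
    have u := F.up (p' - 3) (by omega) le_rfl (by rw [hl]; simp)
    rw [show (p' : ℤ) - 3 + 2 = p' - 1 by ring, show (p' : ℤ) - 3 + 1 = p' - 2 by ring, e2] at u
    have z := pathSum_eq_zero (p' := p') q p ρ a m (b := p' - 1 + 2) (p' - 1) (Or.inr (by omega))
    have i := hC.imageSum_last h0 hq m
    have e : q ^ (((m : ℤ) + 1) * (p - 1)) * q ^ (-(m : ℤ) * (p - 2)) =
      q ^ ((m : ℤ) + (p - 1)) := zpow_mul_zpow h0 (by ring)
    rw [if_pos (Or.inr rfl), z, hQ, show (p' : ℤ) - 1 - 2 = p' - 3 by ring, u]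
    linear_combination qPoch q q m * imageSum q C m (p - 2) (p' - 3) * e - qPoch q q m * i
  rw [if_neg (by omega), hQ]
  have b2 : b + 2 - 2 = b := by ring
  have b2' : b - 2 + 2 = b := by ring
  have b1 : b + 2 - 1 = b + 1 := by ring
  have b1' : b - 2 + 1 = b - 1 := by ring
  have ht := tau_eq (p := p) (p' := p') b
  set g := floorDiv p p' (b - 1) with hg
  -- For `τ(b) = 1` both rows coincide. The correction on the step from `b-2` supplies the negative
  -- term of the symmetric recurrence.
  by_cases hA : ρ b = .oneA
  · have ht1 := hρ.tau_of_ne_two h1 h2 hb hb' (by rw [hA]; simp)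
    have hr1 : floorDiv p p' (b + 1) = r := by omega
    have hg1 : g = r - 1 := by omega
    have d := F.down (b + 2) (by omega) (by omega) (by rw [b2, hA]; simp)
    have f := F.flat_one b (by omega) (by omega) ht1
    have u := F.up_oneA (b - 2) (by omega) (by omega) (by rw [b2', hA])
    rw [b1, b2, hr1] at d
    rw [hr1] at f
    rw [b1', b2', ← hg, hg1, sub_add_cancel] at u
    rw [d, f, u]
    have i := imageSum_recurrence h0 hq C (m + 1) r b
    rw [add_sub_cancel_right, show (m : ℤ) + 1 - 2 = m - 1 by ring] at i
    have e1 : q ^ (-((m : ℤ) + 1) * r) * q ^ ((m : ℤ) * (r + 1)) = q ^ ((m : ℤ) + 1 - r - 1) :=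
      zpow_mul_zpow h0 (by ring)
    have e2 : q ^ ((m : ℤ) + 1) * q ^ (m : ℤ) = q ^ (2 * ((m : ℤ) + 1) - 1) :=
      zpow_mul_zpow h0 (by ring)
    have e3 : q ^ (((m : ℤ) + 1) * r) * q ^ (-(m : ℤ) * (r - 1)) = q ^ ((m : ℤ) + 1 + r - 1) :=
      zpow_mul_zpow h0 (by ring)
    have e4 : q ^ ((m : ℤ) + 1 + r - 1) * q ^ ((m : ℤ) - 1 - (r - 1)) =
      q ^ (2 * ((m : ℤ) + 1) - 2) := zpow_mul_zpow h0 (by ring)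
    linear_combination qPoch q q m * (imageSum q C m (r + 1) (b + 2) * e1 +
      imageSum q C m r b * e2 + (imageSum q C m (r - 1) (b - 2) -
        q ^ ((m : ℤ) - 1 - (r - 1)) * imageSum q C (m - 1) r b) * e3 -
      imageSum q C (m - 1) r b * e4 - i)
  -- Now the correction sits on the step from `b+2`.
  by_cases hB : ρ b = .oneB
  · have ht1 := hρ.tau_of_ne_two h1 h2 hb hb' (by rw [hB]; simp)
    have hr1 : floorDiv p p' (b + 1) = r := by omega
    have hg1 : g = r - 1 := by omega
    have d := F.down_oneB (b + 2) (by omega) (by omega) (by rw [b2, hB])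
    have f := F.flat_one b (by omega) (by omega) ht1
    have u := F.up (b - 2) (by omega) (by omega) (by rw [b2', hB]; simp)
    rw [b1, b2, hr1] at d
    rw [hr1] at f
    rw [b1', b2', ← hg, hg1] at u
    rw [d, f, u]
    have i := imageSum_recurrence h0 hq C (m + 1) r b
    rw [add_sub_cancel_right, show (m : ℤ) + 1 - 2 = m - 1 by ring] at i
    have e1 : q ^ (-((m : ℤ) + 1) * r) * q ^ ((m : ℤ) * (r + 1)) = q ^ ((m : ℤ) + 1 - r - 1) :=
      zpow_mul_zpow h0 (by ring)
    have e2 : q ^ ((m : ℤ) + 1) * q ^ (m : ℤ) = q ^ (2 * ((m : ℤ) + 1) - 1) :=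
      zpow_mul_zpow h0 (by ring)
    have e3 : q ^ (((m : ℤ) + 1) * r) * q ^ (-(m : ℤ) * (r - 1)) = q ^ ((m : ℤ) + 1 + r - 1) :=
      zpow_mul_zpow h0 (by ring)
    have e4 : q ^ ((m : ℤ) + 1 - r - 1) * q ^ ((m : ℤ) + r) =
      q ^ (2 * ((m : ℤ) + 1) - 2) := zpow_mul_zpow h0 (by ring)
    linear_combination qPoch q q m * ((imageSum q C m (r + 1) (b + 2) -
        q ^ ((m : ℤ) + r) * imageSum q C (m - 1) r b) * e1 +
      imageSum q C m r b * e2 + imageSum q C m (r - 1) (b - 2) * e3 -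
      imageSum q C (m - 1) r b * e4 - i)
  have ht2 : tau p p' b = 2 := by
    refine (hρ.two_iff b hb hb').mp ?_
    cases h : ρ b <;> simp_all
  have d := F.down (b + 2) (by omega) (by omega) (by rwa [b2])
  have u := F.up (b - 2) (by omega) (by omega) (by rwa [b2'])
  rw [b1, b2] at d
  rw [b1', b2', ← hg] at u
  -- The rows differ by one: the upper one uses the right recurrence, the lower one the left. The
  -- correction sits on the horizontal step.
  rcases hr with ⟨hr, -⟩ | hr
  · have hg1 : g = r - 2 := by omega
    have f := F.flat_two b (by omega) (by omega) ht2
    rw [← hr] at d f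
    rw [hg1] at u
    rw [d, f, u]
    have i := imageSum_recurrence_right h0 hq C (m + 1) r b
    rw [add_sub_cancel_right, show (m : ℤ) + 1 - 2 = m - 1 by ring] at i
    have e1 : q ^ (-((m : ℤ) + 1) * r) * q ^ ((m : ℤ) * (r + 1)) = q ^ ((m : ℤ) + 1 - r - 1) :=
      zpow_mul_zpow h0 (by ring)
    have e2 : q ^ ((m : ℤ) + 1) * q ^ ((m : ℤ) - 1 - r) = q ^ (2 * ((m : ℤ) + 1) - 2 - r) :=
      zpow_mul_zpow h0 (by ring)
    have e3 : q ^ (((m : ℤ) + 1) * r) * q ^ (-(m : ℤ) * (r - 2)) =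
      q ^ (2 * ((m : ℤ) + 1) + r - 2) := zpow_mul_zpow h0 (by ring)
    linear_combination qPoch q q m * (imageSum q C m (r + 1) (b + 2) * e1 -
      imageSum q C (m - 1) (r + 1) (b + 2) * e2 + imageSum q C m (r - 2) (b - 2) * e3 - i)
  · have hg1 : g = r - 1 := by omega
    have hr1 : floorDiv p p' (b + 1) = r + 1 := by omega
    have f := F.flat_two' b (by omega) (by omega) ht2
    rw [hr1, add_assoc, show (1 : ℤ) + 1 = 2 by norm_num] at d
    rw [← hg, hg1, sub_add_cancel] at f
    rw [hg1] at u
    rw [d, f, u]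
    have i := imageSum_recurrence_left h0 hq C (m + 1) r b
    rw [add_sub_cancel_right, show (m : ℤ) + 1 - 2 = m - 1 by ring] at i
    have e1 : q ^ (-((m : ℤ) + 1) * r) * q ^ ((m : ℤ) * (r + 2)) =
      q ^ (2 * ((m : ℤ) + 1) - 2 - r) := zpow_mul_zpow h0 (by ring)
    have e2 : q ^ ((m : ℤ) + 1) * q ^ ((m : ℤ) + (r - 1)) = q ^ (2 * ((m : ℤ) + 1) - 2 + r) :=
      zpow_mul_zpow h0 (by ring)
    have e3 : q ^ (((m : ℤ) + 1) * r) * q ^ (-(m : ℤ) * (r - 1)) =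
      q ^ ((m : ℤ) + 1 + r - 1) := zpow_mul_zpow h0 (by ring)
    linear_combination qPoch q q m * (imageSum q C m (r + 2) (b + 2) * e1 -
      imageSum q C (m - 1) (r - 1) (b - 2) * e2 + imageSum q C m (r - 1) (b - 2) * e3 - i)

/-- After a common power of `q` is removed, the integer weights of the three steps are those of
`FinalFormula`, except that one may be off by one. The resulting factor `q^(m+1) - 1` turns `(q)_m`
into `-(q)_{m+1}`, and the uncorrected formula for that step gives the new correction. -/
lemma pathFormulas_succ [CharZero K] (h0 : q ≠ 0) (hp : 3 ≤ p) (hcop : Nat.Coprime p p')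
    (h1 : p < p') (h2 : p' < 2 * p) (hC : IsAntisymmetric q p p' C) (hρ : IsLabelling p p' ρ)
    {m : ℕ} (F : PathFormulas q p p' ρ a C m) (T : FinalFormula q p p' ρ a C m) :
    PathFormulas q p p' ρ a C (m + 1) := by
  have hQ := qPoch_self_succ q m
  have b2 (b : ℤ) : b + 2 - 2 = b := by ring
  have b2' (b : ℤ) : b - 2 + 2 = b := by ring
  have b1 (b : ℤ) : b + 2 - 1 = b + 1 := by ring
  have b1' (b : ℤ) : b - 2 + 1 = b - 1 := by ring
  have hup (b : ℤ) (hb : 1 ≤ b) (hb' : b ≤ p' - 3) :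
      pathSum q p p' ρ a (m + 1) b (b + 2) = q ^ (-((m : ℤ) + 1) * floorDiv p p' (b + 1)) *
        (qPoch q q (m + 1) * imageSum q C (m + 1) (floorDiv p p' (b + 1)) b +
        (q ^ (((m : ℤ) + 1) * (ρ (b + 2)).shift) - 1) *
          q ^ (-((m : ℤ) + 1) * floorDiv p p' (b + 1)) * pathSum q p p' ρ a m (b + 2) b) := by
    have t := T b _ hb (by omega) (Or.inl ⟨rfl, by omega⟩)
    set f := floorDiv p p' (b + 1) with hf
    have w1 : intWeight p p' ρ (b + 2) b (b + 2) = -2 * f + (ρ (b + 2)).shift := by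
      rw [intWeight, if_pos rfl, if_pos rfl]
    have w2 : intWeight p p' ρ b b (b + 2) = 1 - f := by
      rw [intWeight, if_pos rfl, if_neg (by omega), if_pos rfl]
    have w3 : intWeight p p' ρ (b - 2) b (b + 2) = 0 := by
      rw [intWeight, if_pos rfl, if_neg (by omega), if_neg (by omega)]
    rw [pathSum_succ h0 p ρ a hb (by omega), ← t, w1, w2, w3]
    have e1 : q ^ (((m : ℤ) + 1) * (-2 * f + (ρ (b + 2)).shift)) = q ^ (-((m : ℤ) + 1) * f) *
        q ^ (-((m : ℤ) + 1) * f) * q ^ (((m : ℤ) + 1) * (ρ (b + 2)).shift) := by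
      rw [← zpow_add₀ h0, ← zpow_add₀ h0]; congr 1; ring
    have e2 : q ^ (((m : ℤ) + 1) * (1 - f)) = q ^ (-((m : ℤ) + 1) * f) * q ^ ((m : ℤ) + 1) := by
      rw [← zpow_add₀ h0]; congr 1; ring
    have e3 : q ^ (-((m : ℤ) + 1) * f) * q ^ (((m : ℤ) + 1) * f) = q ^ (((m : ℤ) + 1) * 0) :=
      zpow_mul_zpow h0 (by ring)
    rw [e1, e2, ← e3]
    split_ifs <;> ring
  have hdown (b : ℤ) (hb : 3 ≤ b) (hb' : b ≤ p' - 1) :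
      pathSum q p p' ρ a (m + 1) b (b - 2) =
        q ^ (((m : ℤ) + 1) * (floorDiv p p' (b - 1) + 1)) *
        (qPoch q q (m + 1) * imageSum q C (m + 1) (floorDiv p p' (b - 1) + 1) b +
        (q ^ (((m : ℤ) + 1) * ((ρ (b - 2)).x - 2)) - 1) *
          q ^ (((m : ℤ) + 1) * (floorDiv p p' (b - 1) + 1)) *
            pathSum q p p' ρ a m (b - 2) b) := by
    have t := T b _ (by omega) hb' (Or.inr rfl)
    set f := floorDiv p p' (b - 1) with hf
    have w1 : intWeight p p' ρ (b + 2) b (b - 2) = 0 := by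
      rw [intWeight, if_neg (by omega), if_neg (by omega), if_pos rfl]
    have w2 : intWeight p p' ρ b b (b - 2) = 2 + f := by
      rw [intWeight, if_neg (by omega), if_neg (by omega), if_neg (by omega), if_pos rfl]
    have w3 : intWeight p p' ρ (b - 2) b (b - 2) = 2 * f + (ρ (b - 2)).x := by
      rw [intWeight, if_neg (by omega), if_neg (by omega), if_neg (by omega), if_neg (by omega)]
    rw [pathSum_succ h0 p ρ a (by omega) hb', ← t, w1, w2, w3]
    have e1 : q ^ (((m : ℤ) + 1) * (2 * f + (ρ (b - 2)).x)) = q ^ (((m : ℤ) + 1) * (f + 1)) *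
        q ^ (((m : ℤ) + 1) * (f + 1)) * q ^ (((m : ℤ) + 1) * ((ρ (b - 2)).x - 2)) := by
      rw [← zpow_add₀ h0, ← zpow_add₀ h0]; congr 1; ring
    have e2 : q ^ (((m : ℤ) + 1) * (2 + f)) =
        q ^ (((m : ℤ) + 1) * (f + 1)) * q ^ ((m : ℤ) + 1) := by
      rw [← zpow_add₀ h0]; congr 1; ring
    have e3 : q ^ (((m : ℤ) + 1) * (f + 1)) * q ^ (-((m : ℤ) + 1) * (f + 1)) =
        q ^ (((m : ℤ) + 1) * 0) :=
      zpow_mul_zpow h0 (by ring)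
    rw [e1, e2, ← e3]
    split_ifs <;> ring
  have hflat (b : ℤ) (hb : 2 ≤ b) (hb' : b ≤ p' - 2) :
      pathSum q p p' ρ a (m + 1) b b =
        q ^ (((m : ℤ) + 1) * (1 - floorDiv p p' (b + 1))) * pathSum q p p' ρ a m (b + 2) b +
        q ^ (((m : ℤ) + 1) * (3 - tau p p' b)) * pathSum q p p' ρ a m b b +
        q ^ (((m : ℤ) + 1) * (2 + floorDiv p p' (b - 1))) * pathSum q p p' ρ a m (b - 2) b := by
    have w1 : intWeight p p' ρ (b + 2) b b = 1 - floorDiv p p' (b + 1) := by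
      rw [intWeight, if_neg (by omega), if_pos rfl, if_pos rfl]
    have w2 : intWeight p p' ρ b b b = 3 - tau p p' b := by
      rw [intWeight, if_neg (by omega), if_pos rfl, if_neg (by omega), if_pos rfl]
    have w3 : intWeight p p' ρ (b - 2) b b = 2 + floorDiv p p' (b - 1) := by
      rw [intWeight, if_neg (by omega), if_pos rfl, if_neg (by omega), if_neg (by omega)]
    rw [pathSum_succ h0 p ρ a (by omega) (by omega), w1, w2, w3, if_neg (by omega)]
  have hshift (l : Label) (hl : l ≠ .oneA) : l.shift = 0 := by
    cases l <;> simp_all [Label.shift]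
  have hx (l : Label) (hl : l ≠ .oneB) : l.x - 2 = 0 := by
    cases l <;> simp_all [Label.x]
  have ht (b : ℤ) := tau_eq (p := p) (p' := p') b
  refine ⟨fun b hb hb' hl => ?_, fun b hb hb' hl => ?_, fun b hb hb' hl => ?_,
    fun b hb hb' hl => ?_, fun b hb hb' hl => ?_, fun b hb hb' hl => ?_, fun b hb hb' hl => ?_⟩ <;>
    push_cast <;> try rw [add_sub_cancel_right]
  -- No path ends on the wall, and the image sum vanishes there because its row is `[1/t] = 0`.
  · by_cases hb0 : b = 0
    · subst hb0
      rw [pathSum_eq_zero q p ρ a _ _ (Or.inl (by norm_num)), zero_add, floorDiv_one h1,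
        hC.imageSum_zero_zero h0]
      ring
    rw [hup b (by omega) hb', hshift _ hl, mul_zero, zpow_zero]
    ring
  · have hb0 : b ≠ 0 := by
      rintro rfl
      exact hρ.two_ne_oneA hcop hp h1 h2 hl
    -- Condition (iv): `b` is not labelled `1_B`, so the step from `b+2` to `b` has no correction.
    have d := F.down (b + 2) (by omega) (by omega) fun h => by
      rw [b2] at h
      exact hρ.no_BA b (by omega) (by omega) h hl
    rw [b2, b1] at d
    rw [hup b (by omega) hb', hl, d, hQ, show Label.oneA.shift = 1 from rfl, mul_one]
    set f := floorDiv p p' (b + 1)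
    have e : q ^ (-((m : ℤ) + 1) * f) * q ^ ((m : ℤ) * (f + 1)) = q ^ ((m : ℤ) - f) :=
      zpow_mul_zpow h0 (by ring)
    linear_combination q ^ (-((m : ℤ) + 1) * f) * (q ^ ((m : ℤ) + 1) - 1) * qPoch q q m *
      imageSum q C m (f + 1) (b + 2) * e
  · by_cases hb0 : b = p'
    · subst hb0
      rw [pathSum_eq_zero q p ρ a _ _ (Or.inr (by omega)), floorDiv_last_sub_one h1 h2,
        sub_add_cancel, hC.imageSum_wall h0]
      ring
    rw [hdown b hb (by omega), hx _ hl, mul_zero, zpow_zero]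
    ring
  · have hb0 : b ≠ p' := by
      rintro rfl
      exact hρ.last_ne_oneB hcop hp h1 h2 hl
    have u := F.up (b - 2) (by omega) (by omega) fun h =>
      hρ.no_BA (b - 2) (by omega) (by omega) hl h
    rw [b2', b1'] at u
    rw [hdown b hb (by omega), hl, u, hQ, show Label.oneB.x - 2 = 1 from rfl, mul_one]
    set f := floorDiv p p' (b - 1)
    have e : q ^ (((m : ℤ) + 1) * (f + 1)) * q ^ (-(m : ℤ) * f) = q ^ ((m : ℤ) + 1 + f) :=
      zpow_mul_zpow h0 (by ring)
    linear_combination q ^ (((m : ℤ) + 1) * (f + 1)) * (q ^ ((m : ℤ) + 1) - 1) * qPoch q q m *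
      imageSum q C m f (b - 2) * e
  · have t := T b _ (by omega) (by omega) (Or.inl ⟨rfl, hb'⟩)
    have e := ht b
    have hg : floorDiv p p' (b - 1) = floorDiv p p' (b + 1) - 1 := by omega
    rw [if_neg (by omega)] at t
    rw [hflat b hb hb', hl, hg]
    set f := floorDiv p p' (b + 1)
    have e1 : q ^ ((m : ℤ) + 1) * q ^ (-((m : ℤ) + 1) * f) = q ^ (((m : ℤ) + 1) * (1 - f)) :=
      zpow_mul_zpow h0 (by ring)
    have e2 : q ^ ((m : ℤ) + 1) * q ^ ((m : ℤ) + 1) = q ^ (((m : ℤ) + 1) * (3 - 1)) :=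
      zpow_mul_zpow h0 (by ring)
    have e3 : q ^ ((m : ℤ) + 1) * q ^ (((m : ℤ) + 1) * f) = q ^ (((m : ℤ) + 1) * (2 + (f - 1))) :=
      zpow_mul_zpow h0 (by ring)
    rw [← e1, ← e2, ← e3]
    linear_combination q ^ ((m : ℤ) + 1) * t
  -- Relative to the upper row only the step from `b+2` is off by one.
  · have t := T b _ (by omega) (by omega) (Or.inl ⟨rfl, hb'⟩)
    have e := ht b
    have hg : floorDiv p p' (b - 1) = floorDiv p p' (b + 1) - 2 := by omega
    have hl' := (hρ.two_iff b (by omega) (by omega)).mpr hl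
    have d := F.down (b + 2) (by omega) (by omega) (by rw [b2, hl']; simp)
    rw [b2, b1] at d
    rw [if_neg (by omega)] at t
    rw [hflat b hb hb', hl, hg]
    set f := floorDiv p p' (b + 1)
    have e1 : q ^ ((m : ℤ) + 1) * q ^ (-((m : ℤ) + 1) * f) = q ^ (((m : ℤ) + 1) * (1 - f)) :=
      zpow_mul_zpow h0 (by ring)
    have e4 : q ^ (-((m : ℤ) + 1) * f) * q ^ ((m : ℤ) * (f + 1)) = q ^ ((m : ℤ) - f) :=
      zpow_mul_zpow h0 (by ring)
    rw [← e1, show 2 + (f - 2) = f by ring, show ((m : ℤ) + 1) * (3 - 2) = m + 1 by ring]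
    rw [mul_sub, ← t, hQ]
    linear_combination (q ^ ((m : ℤ) + 1) - 1) * q ^ (-((m : ℤ) + 1) * f) * d +
      (q ^ ((m : ℤ) + 1) - 1) * qPoch q q m * imageSum q C m (f + 1) (b + 2) * e4
  -- Relative to the lower row only the step from `b-2` is off by one.
  · have t := T b _ (by omega) (by omega) (Or.inr rfl)
    have e := ht b
    have hg : floorDiv p p' (b + 1) = floorDiv p p' (b - 1) + 2 := by omega
    have hl' := (hρ.two_iff b (by omega) (by omega)).mpr hl
    have u := F.up (b - 2) (by omega) (by omega) (by rw [b2', hl']; simp)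
    rw [b2', b1'] at u
    rw [if_neg (by omega)] at t
    rw [hflat b hb hb', hl, hg]
    set f := floorDiv p p' (b - 1)
    have e3 : q ^ ((m : ℤ) + 1) * q ^ (((m : ℤ) + 1) * (f + 1)) =
      q ^ (((m : ℤ) + 1) * (2 + f)) := zpow_mul_zpow h0 (by ring)
    have e4 : q ^ (((m : ℤ) + 1) * (f + 1)) * q ^ (-(m : ℤ) * f) = q ^ ((m : ℤ) + 1 + f) :=
      zpow_mul_zpow h0 (by ring)
    rw [← e3, show ((m : ℤ) + 1) * (1 - (f + 2)) = -((m : ℤ) + 1) * (f + 1) by ring,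
      show ((m : ℤ) + 1) * (3 - 2) = m + 1 by ring]
    rw [mul_sub, ← t, hQ]
    linear_combination (q ^ ((m : ℤ) + 1) - 1) * q ^ (((m : ℤ) + 1) * (f + 1)) * u +
      (q ^ ((m : ℤ) + 1) - 1) * qPoch q q m * imageSum q C m f (b - 2) * e4

theorem finalFormula [CharZero K] (h0 : q ≠ 0) (hq : ∀ n : ℕ, 0 < n → q ^ n ≠ 1) (hp : 3 ≤ p)
    (hcop : Nat.Coprime p p') (h1 : p < p') (h2 : p' < 2 * p) (hρ : IsLabelling p p' ρ)
    (ha : 1 ≤ a) (ha' : a ≤ p' - 1) (m : ℕ) :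
    FinalFormula q p p' ρ a (imageCoeff q p p' a) m := by
  have hC := isAntisymmetric_imageCoeff h0 p (by omega : 0 < p') a
  refine finalFormula_of_pathFormulas h0 hq hp h1 h2 hC hρ ?_
  induction m with
  | zero =>
    exact pathFormulas_zero h0 hC ha ha' fun b hb hb' => imageCoeff_of_mem q p ha ha' hb hb'
  | succ k ih =>
    exact pathFormulas_succ h0 hp hcop h1 h2 hC hρ ih
      (finalFormula_of_pathFormulas h0 hq hp h1 h2 hC hρ ih)

end Induction

/-! ### The row of a minimizer and the final comparison -/

section Main

variable {p p' : ℕ}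

lemma tpar_pos (hp : 0 < p) (hp' : 0 < p') : 0 < tpar p p' := by
  unfold tpar
  positivity

lemma confWeight_le_iff (hp : 0 < p) (hp' : 0 < p') (r b s : ℤ) :
    confWeight p p' r b ≤ confWeight p p' r s ↔ (r * p' - b * p) ^ 2 ≤ (r * p' - s * p) ^ 2 := by
  have ht := tpar_pos hp hp'
  have hpq : (0 : ℚ) < p := by exact_mod_cast hp
  have e (x : ℤ) : ((r : ℚ) * tpar p p' - x) ^ 2 = (r * p' - x * p) ^ 2 / p ^ 2 := by
    unfold tpar
    field_simp
  unfold confWeight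
  rw [div_le_div_iff_of_pos_right (by positivity), sub_le_sub_iff_right, e, e,
    div_le_div_iff_of_pos_right (by positivity)]
  norm_cast

lemma confWeight_sub (hp : 0 < p) (hp' : 0 < p') (r d b : ℤ) :
    confWeight p p' r d - confWeight p p' r b =
      quadWeight p p' d - quadWeight p p' b + r * ((b : ℚ) - d) / 2 := by
  have ht := (tpar_pos hp hp').ne'
  unfold confWeight quadWeight
  field_simp
  ring

/-- Minimality means `|rt - b| ≤ 1`, and coprimality makes the lower bound on `r` strict: `[(b-1)/t]
< r ≤ [(b+1)/t]`. As `τ(b) ≤ 2`, this leaves only the two extreme rows. -/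
lemma IsMinimizer.row_eq (hp : 3 ≤ p) (hcop : Nat.Coprime p p') (h1 : p < p') (h2 : p' < 2 * p)
    {r a b : ℤ} (hr : 1 ≤ r) (hr' : r ≤ p - 1) (h : IsMinimizer p p' r a b) :
    (r = floorDiv p p' (b + 1) ∧ b ≤ p' - 2) ∨ r = floorDiv p p' (b - 1) + 1 := by
  obtain ⟨hb, hb', hpar, hmin⟩ := h
  have hp' : 0 < p' := by omega
  have z1 : (p : ℤ) < p' := by exact_mod_cast h1
  have z3 : (3 : ℤ) ≤ p := by exact_mod_cast hp
  -- Comparison with `b+2`; near the wall, where `b+2` is not admissible, `r ≤ p-1` suffices.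
  have hup : r * p' ≤ (b + 1) * p := by
    by_cases hb2 : b + 2 ≤ p' - 1
    · have := (confWeight_le_iff (by omega) hp' r b (b + 2)).mp
        (hmin (b + 2) (by omega) hb2 (by unfold Int.ModEq at *; omega))
      nlinarith
    · have : (p' : ℤ) - 1 ≤ b + 1 := by omega
      nlinarith
  have hdown : (b - 1) * p ≤ r * p' := by
    by_cases hb2 : 1 ≤ b - 2
    · have := (confWeight_le_iff (by omega) hp' r b (b - 2)).mp
        (hmin (b - 2) hb2 (by omega) (by unfold Int.ModEq at *; omega))
      nlinarith
    · have : b - 1 ≤ 1 := by omega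
      nlinarith
  have hcop' : IsCoprime (p' : ℤ) p := Nat.isCoprime_iff_coprime.mpr hcop.symm
  have hne : (b - 1) * p ≠ r * p' := fun h => by
    have hd : (p' : ℤ) ∣ b - 1 := hcop'.dvd_of_dvd_mul_right ⟨r, by linarith⟩
    by_cases hb1 : b = 1
    · subst hb1
      nlinarith
    · have := Int.le_of_dvd (by omega) hd
      omega
  have a1 := floorDiv_le (p := p) hp' (b - 1)
  have a2 := lt_floorDiv (p := p) hp' (b + 1)
  have hlt := lt_of_le_of_ne hdown hne
  have c1 : floorDiv p p' (b - 1) < r := by nlinarith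
  have c2 : r ≤ floorDiv p p' (b + 1) := by nlinarith
  have c3 := floorDiv_add_two h1 h2 (b - 1)
  rw [show b - 1 + 2 = b + 1 by ring] at c3
  -- Here `[(b+1)/t] = p` exceeds the range of `r`, so only `r = p-1 = [(b-1)/t]+1` remains.
  by_cases hl : b = p' - 1
  · rw [hl, sub_add_cancel, floorDiv_last h1 h2] at c3
    rw [hl] at c1 ⊢
    omega
  · omega

/-- The exponent on a path, as an integer. -/
def intExponent (p p' : ℕ) (ρ : ℤ → Label) (r a b : ℤ) (m : ℕ) (s : Fin (m + 1) → ℤ) : ℤ :=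
  intEnergy p p' ρ s + (m * (r * ((b - vertex s (m - 1)) / 2) +
    if vertex s (m - 1) = b then 1 else 0) + r * ((a - b) / 2))

/-- With `Q = quadWeight` and `m = k+1`, the energy leaves `k Q(b) - (k+1) Q(s_k) + Q(a)`; the
conformal weights contribute `(k+1)(Q(s_k) - Q(b)) + Q(b) - Q(a)`, its exact negative. -/
lemma intExponent_eq (hp : 3 ≤ p) (h1 : p < p') (h2 : p' < 2 * p) {ρ : ℤ → Label}
    (hρ : IsLabelling p p' ρ) {r a b : ℤ} (hab : b ≡ a [ZMOD 2]) {m : ℕ}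
    {s : Fin (m + 1) → ℤ} (hs : s ∈ paths p' a b m) :
    (intExponent p p' ρ r a b m s : ℚ) = exponent p p' ρ r a b s := by
  obtain ⟨hr, e0, el, hst⟩ := mem_paths.mp hs
  cases m with
  | zero =>
    obtain rfl : a = b := e0.symm.trans el
    simp [intExponent, exponent, intEnergy, energy]
  | succ k =>
    have hv : vertex s (k + 1 - 1) = vertex s k := rfl
    have hsv : s ⟨k + 1 - 1, by omega⟩ = vertex s k := (vertex_of_lt s (by omega)).symm
    have hstep : IsStep p' (vertex s k) b := by
      rw [vertex_of_lt s (by omega : k < k + 1 + 1), ← el]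
      exact hst ⟨k, by omega⟩
    obtain ⟨β, hβ⟩ : ∃ β, a = b + 2 * β := ⟨(a - b) / 2, by unfold Int.ModEq at hab; omega⟩
    obtain ⟨δ, hδ⟩ : ∃ δ, b - vertex s k = 2 * δ := by
      rcases hstep.1 with h | h | h
      · exact ⟨0, by omega⟩
      · exact ⟨-1, by omega⟩
      · exact ⟨1, by omega⟩
    have c1 := confWeight_sub (p := p) (p' := p') (by omega) (by omega) r (vertex s k) b
    have c2 := confWeight_sub (p := p) (p' := p') (by omega) (by omega) r b a
    have hδ' : (b : ℚ) - vertex s k = 2 * δ := by exact_mod_cast hδ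
    have hβ' : (a : ℚ) - b = 2 * β := by
      rw [hβ]
      push_cast
      ring
    rw [hδ'] at c1
    rw [hβ'] at c2
    unfold intExponent exponent
    rw [energy_eq h1 h2 hρ hs, hv, hsv, hδ, Int.mul_ediv_cancel_left _ (by norm_num),
      show (a - b) / 2 = β by omega, c1, add_sub_assoc, c2]
    push_cast
    ring

/-- For `m > 0` this is `FinalFormula` at `b` times `q^(r(a-b)/2)`: the boundary term equals `-mr`,
`m`, `mr` for a last step from `b+2`, `b`, `b-2`. -/
theorem altSum_eq_sum_paths {K : Type*} [Field K] [CharZero K] {q : K} (h0 : q ≠ 0)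
    (hq : ∀ n : ℕ, 0 < n → q ^ n ≠ 1) (hp : 3 ≤ p) (hcop : Nat.Coprime p p') (h1 : p < p')
    (h2 : p' < 2 * p) {ρ : ℤ → Label} (hρ : IsLabelling p p' ρ) {r a b : ℤ} (hr : 1 ≤ r)
    (hr' : r ≤ p - 1) (ha : 1 ≤ a) (ha' : a ≤ p' - 1) (hb : IsMinimizer p p' r a b) (m : ℕ) :
    altSum q p p' r a b m = ∑ s ∈ paths p' a b m, q ^ intExponent p p' ρ r a b m s := by
  obtain ⟨β, hβ⟩ : ∃ β, a = b + 2 * β :=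
    ⟨(a - b) / 2, by have := hb.parity; unfold Int.ModEq at this; omega⟩
  have hp' : 0 < p' := by omega
  rw [altSum_eq h0 hq p hp' r a b β hβ]
  cases m with
  | zero =>
    rw [Nat.cast_zero, imageSum_zero, imageCoeff_of_mem q p ha ha' hb.one_le hb.le,
      paths_zero ha ha']
    split_ifs with h
    · obtain rfl : β = 0 := by omega
      subst h
      simp [qPoch, intExponent, intEnergy]
    · simp
  | succ k =>
    have T := finalFormula h0 hq hp hcop h1 h2 hρ ha ha' k b r hb.one_le hb.le
      (hb.row_eq hp hcop h1 h2 hr hr')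
    have P := sum_paths_zpow h0 p ρ a hb.one_le hb.le k fun d =>
      (((k : ℤ) + 1) * (r * ((b - d) / 2) + if d = b then 1 else 0) + r * ((a - b) / 2))
    have hs (s : Fin (k + 1 + 1) → ℤ) : intExponent p p' ρ r a b (k + 1) s = intEnergy p p' ρ s +
        (((k : ℤ) + 1) * (r * ((b - vertex s k) / 2) + if vertex s k = b then 1 else 0) +
          r * ((a - b) / 2)) := by
      rw [intExponent, Nat.cast_succ]
      rfl
    simp only [hs]
    rw [P, show (b - (b + 2)) / 2 = -1 by omega, show (b - b) / 2 = 0 by omega,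
      show (b - (b - 2)) / 2 = 1 by omega, show (a - b) / 2 = β by omega,
      if_neg (by omega : ¬ b + 2 = b), if_pos (rfl : b = b), if_neg (by omega : ¬ b - 2 = b)]
    have e1 : q ^ (((k : ℤ) + 1) * (r * -1 + 0) + r * β) =
        q ^ (-((k : ℤ) + 1) * r) * q ^ (r * β) := by
      rw [← zpow_add₀ h0]; congr 1; ring
    have e2 : q ^ (((k : ℤ) + 1) * (r * 0 + 1) + r * β) = q ^ ((k : ℤ) + 1) * q ^ (r * β) := by
      rw [← zpow_add₀ h0]; congr 1; ring
    have e3 : q ^ (((k : ℤ) + 1) * (r * 1 + 0) + r * β) =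
        q ^ (((k : ℤ) + 1) * r) * q ^ (r * β) := by
      rw [← zpow_add₀ h0]; congr 1; ring
    rw [e1, e2, e3]
    push_cast
    rw [mul_right_comm, ← T]
    split_ifs <;> ring

lemma ratFunc_X_pow_ne_one (n : ℕ) (hn : 0 < n) : (RatFunc.X : RatFunc ℚ) ^ n ≠ 1 := by
  intro h
  rw [← RatFunc.algebraMap_X, ← map_pow, ← map_one (algebraMap (Polynomial ℚ) (RatFunc ℚ))] at h
  have h' := congrArg Polynomial.natDegree (RatFunc.algebraMap_injective ℚ h)
  rw [Polynomial.natDegree_X_pow, Polynomial.natDegree_one] at h'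
  omega

end Main
end

end VirasoroPaths

theorem proposition2p2 (p p' : ℕ) (hp : 3 ≤ p) (hcop : Nat.Coprime p p')
    (ht1 : 1 < VirasoroPaths.tpar p p') (ht2 : VirasoroPaths.tpar p p' < 2) :
    VirasoroPaths.IsLabelling p p' (VirasoroPaths.standardLabel p p') ∧
    ∀ ρ : ℤ → VirasoroPaths.Label, VirasoroPaths.IsLabelling p p' ρ →
    ∀ r a b : ℤ, 1 ≤ r → r ≤ p - 1 → 1 ≤ a → a ≤ p' - 1 →
    VirasoroPaths.IsMinimizer p p' r a b →
    ∀ m : ℕ,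
      (∃ N : (Fin (m + 1) → ℤ) → ℤ,
        (∀ s ∈ VirasoroPaths.paths p' a b m,
          (N s : ℚ) = VirasoroPaths.exponent p p' ρ r a b s) ∧
        VirasoroPaths.altSum (RatFunc.X : RatFunc ℚ) p p' r a b m =
          ∑ s ∈ VirasoroPaths.paths p' a b m, (RatFunc.X : RatFunc ℚ) ^ N s) ∧
      ∃ c : ℤ →₀ ℕ,
        VirasoroPaths.altSum (RatFunc.X : RatFunc ℚ) p p' r a b m =
          c.sum fun n k => (k : RatFunc ℚ) * (RatFunc.X : RatFunc ℚ) ^ n := by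
  have h1 := (VirasoroPaths.one_lt_tpar_iff (by omega)).mp ht1
  have h2 := (VirasoroPaths.tpar_lt_two_iff (by omega)).mp ht2
  refine ⟨VirasoroPaths.isLabelling_standardLabel hp hcop h1 h2,
    fun ρ hρ r a b hr hr' ha ha' hb m => ?_⟩
  have key := VirasoroPaths.altSum_eq_sum_paths (RatFunc.X_ne_zero (K := ℚ))
    VirasoroPaths.ratFunc_X_pow_ne_one hp hcop h1 h2 hρ hr hr' ha ha' hb m
  refine ⟨⟨VirasoroPaths.intExponent p p' ρ r a b m,
    fun s hs => VirasoroPaths.intExponent_eq hp h1 h2 hρ hb.parity hs, key⟩,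
    ∑ s ∈ VirasoroPaths.paths p' a b m,
      Finsupp.single (VirasoroPaths.intExponent p p' ρ r a b m s) 1, ?_⟩
  rw [key, ← Finsupp.sum_finsetSum_index (fun n => by simp)
    (fun n k l => by push_cast; ring)]
  exact Finset.sum_congr rfl fun s _ => by rw [Finsupp.sum_single_index] <;> simp
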